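/- Let $\gamma>2$. There is a constant $C>0$ depending only on $\gamma$ with the following property. Let $\alpha_0,\alpha_1,\kappa>0$, let $(\Omega,\mathcal F,\mathbb P)$ be a probability space with a measurable, measure-preserving, ergodic action $(\tau_x)_{x\in\mathbb R}$ of $\mathbb R$, and let $a:\mathbb R\times\Omega\to[0,1]$ (measurable) and $H:\mathbb R\times\mathbb R\times\Omega\to\mathbb R$ be stationary, i.e. $a(x+y,\omega)=a(x,\tau_y\omega)$ and $H(x+y,p,\omega)=H(x,p,\tau_y\omega)$. Assume that $a(\cdot,\omega)>0$ on $\mathbb R$ for $\mathbb P$-a.e. $\omega$, that $\sqrt{a(\cdot,\omega)}$ is $\kappa$-Lipschitz for all $\omega$, and that for all $x,y,p,q\in\mathbb R$ and $\omega\in\Omega$ $$\alpha_0|p|^\gamma-\tfrac1{\alpha_0}\le H(x,p,\omega)\le\alpha_1(|p|^\gamma+1),$$ $$|H(x,p,\omega)-H(x,q,\omega)|\le\alpha_1(|p|+|q|+1)^{\gamma-1}|p-q|,\qquad |H(x,p,\omega)-H(y,p,\omega)|\le\alpha_1(|p|^\gamma+1)|x-y|.$$ For $\omega\in\Omega$ let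 $\lambda_0(\omega)$ be the infimum of all $\lambda\in\mathbb R$ for which the equation $$a(x,\omega)u''+H(x,u',\omega)=\lambda\quad\text{in }\mathbb R\qquad(\mathrm{HJ}_\lambda)$$ admits a continuous viscosity supersolution. (A continuous $u$ is a viscosity supersolution, resp. subsolution, if $a(x_0,\omega)\varphi''(x_0)+H(x_0,\varphi'(x_0),\omega)\le\lambda$, resp. $\ge\lambda$, whenever $\varphi\in C^2(\mathbb R)$ and $u-\varphi$ has a local minimum, resp. maximum, at $x_0$; it is a viscosity solution if it is both.) Then for every $\omega\in\Omega$ and every real $\lambda\ge\lambda_0(\omega)$ the equation $(\mathrm{HJ}_\lambda)$ has a viscosity solution $u$ such that $|u(x)-u(y)|\le K|x-y|$ for all $x,y\in\mathbb R$, where $$K=C\left(\left(\kappa\,\frac{\sqrt{1+\alpha_1+|\lambda|}}{\alpha_0}\right)^{\frac2{\gamma-1}}+\left(\frac{1+\lambda\alpha_0}{\alpha_0^2}\right)^{\frac1\gamma}\right)>0,$$ and $u$ is of class $C^2$ on $\mathbb R$ if $a(\cdot,\omega)>0$ on $\mathbb R$ (hence for $\mathbb P$-a.e. $\omega$). Moreover,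 for every $\omega\in\Omega$, $$\lambda_0(\omega)\ \ge\ \inf_{(x,p)\in\mathbb R^2}H(x,p,\omega)\ \ge\ -\frac1{\alpha_0}.$$ -/

import Mathlib

open MeasureTheory

noncomputable section

namespace ViscousHJ

/-- `(τ x)` is a measurable one-parameter group of transformations of `Ω` which preserves `P` and
acts ergodically. -/
structure IsErgodicFlow {Ω : Type*} [MeasurableSpace Ω] (P : Measure Ω) (τ : ℝ → Ω → Ω) :
    Prop where
  measurable : Measurable fun z : ℝ × Ω => τ z.1 z.2
  zero : ∀ ω, τ 0 ω = ω
  add : ∀ x y ω, τ (x + y) ω = τ x (τ y ω)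
  preserves : ∀ x, MeasurePreserving (τ x) P P
  ergodic : ∀ φ : Ω → ℝ, Measurable φ → (∀ x, ∀ᵐ ω ∂P, φ (τ x ω) = φ ω) →
    ∃ c : ℝ, ∀ᵐ ω ∂P, φ ω = c

/-- The diffusion coefficient: a measurable stationary function with values in `[0, 1]`, almost
surely positive on `ℝ`, and with `κ`-Lipschitz square root. -/
structure IsDiffusionCoeff {Ω : Type*} [MeasurableSpace Ω] (P : Measure Ω) (τ : ℝ → Ω → Ω)
    (κ : ℝ) (a : ℝ → Ω → ℝ) : Prop where
  measurable : Measurable fun z : ℝ × Ω => a z.1 z.2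
  stationary : ∀ x y ω, a (x + y) ω = a x (τ y ω)
  mem_Icc : ∀ x ω, a x ω ∈ Set.Icc (0 : ℝ) 1
  ae_pos : ∀ᵐ ω ∂P, ∀ x, 0 < a x ω
  sqrt_lipschitz : ∀ ω x y, |√(a x ω) - √(a y ω)| ≤ κ * |x - y|

/-- The class of Hamiltonians `H(x, p, ω)` with growth exponent `γ` and constants `α₀`, `α₁`. -/
structure HamiltonianClass {Ω : Type*} (α₀ α₁ γ : ℝ) (H : ℝ → ℝ → Ω → ℝ) : Prop where
  lower : ∀ x p ω, α₀ * |p| ^ γ - 1 / α₀ ≤ H x p ω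
  upper : ∀ x p ω, H x p ω ≤ α₁ * (|p| ^ γ + 1)
  lipschitz_p : ∀ x p q ω, |H x p ω - H x q ω| ≤ α₁ * (|p| + |q| + 1) ^ (γ - 1) * |p - q|
  lipschitz_x : ∀ x y p ω, |H x p ω - H y p ω| ≤ α₁ * (|p| ^ γ + 1) * |x - y|

/-- `u` is a continuous viscosity subsolution of `a(x) u'' + G(x, u') = l` in `ℝ`: whenever a `C²`
function `φ` touches `u` from above at `x₀`, one has `a(x₀) φ''(x₀) + G(x₀, φ'(x₀)) ≥ l`. -/
def IsViscositySubsolution (a : ℝ → ℝ) (G : ℝ → ℝ → ℝ) (l : ℝ) (u : ℝ → ℝ) : Prop :=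
  Continuous u ∧ ∀ (φ : ℝ → ℝ) (x₀ : ℝ), ContDiff ℝ 2 φ → IsLocalMax (fun x => u x - φ x) x₀ →
    l ≤ a x₀ * deriv (deriv φ) x₀ + G x₀ (deriv φ x₀)

/-- `u` is a continuous viscosity supersolution of `a(x) u'' + G(x, u') = l` in `ℝ`: whenever a
`C²` function `φ` touches `u` from below at `x₀`, one has
`a(x₀) φ''(x₀) + G(x₀, φ'(x₀)) ≤ l`. -/
def IsViscositySupersolution (a : ℝ → ℝ) (G : ℝ → ℝ → ℝ) (l : ℝ) (u : ℝ → ℝ) : Prop :=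
  Continuous u ∧ ∀ (φ : ℝ → ℝ) (x₀ : ℝ), ContDiff ℝ 2 φ → IsLocalMin (fun x => u x - φ x) x₀ →
    a x₀ * deriv (deriv φ) x₀ + G x₀ (deriv φ x₀) ≤ l

/-- Continuous viscosity solutions of `a(x) u'' + G(x, u') = l` in `ℝ`. -/
def IsViscositySolution (a : ℝ → ℝ) (G : ℝ → ℝ → ℝ) (l : ℝ) (u : ℝ → ℝ) : Prop :=
  IsViscositySubsolution a G l u ∧ IsViscositySupersolution a G l u

/-- The critical value: the infimum of the real levels `l` at which `a(x) u'' + G(x, u') = l` has a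
continuous viscosity supersolution. It is taken in the extended reals, so that no convention on
unbounded or empty sets intervenes. -/
def criticalValue (a : ℝ → ℝ) (G : ℝ → ℝ → ℝ) : EReal :=
  sInf ((fun l : ℝ => (l : EReal)) '' {l : ℝ | ∃ w : ℝ → ℝ, IsViscositySupersolution a G l w})

/-- The explicit Lipschitz constant, with a prefactor `C`. -/
def lipConst (C α₀ α₁ γ κ l : ℝ) : ℝ :=
  C * ((κ * (√(1 + α₁ + |l|) / α₀)) ^ (2 / (γ - 1)) + ((1 + l * α₀) / α₀ ^ 2) ^ (1 / γ))

end ViscousHJ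

end

/-! Fix `ω`. The heart of the matter is an a priori bound: if `K > 0`, `l ≥ -1/α₀` and `l + 1/α₀ <
α₀ K ^ γ`, every continuous supersolution at level `l` on the whole line is `K`-Lipschitz
(`SupersolutionOn.lipschitz`). Since `γ > 2`, there is `c > 0` with `H > l + c p²` for `|p| ≥ K`.
Suppose `w` has slope below `-K` at `x₀`. If `g = -1/r ≤ -K` with `r > 0` and `a r' ≥ -c`, then `a
g' = a r' g² ≥ -c g²`, so `a g' + H(x, g) > l`: a primitive of `g` is a strict subsolution. Such a
`g` can be made to reach `-∞` at finite distance to the right of `x₀`, before `a` degenerates: if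
`d` is the first zero of `a`, then `a ≤ κ²(d - x)²`, and `r` may fall like `-1/(d - x)`, hence
vanishes before `d`; if there is no zero, a linear `r` will do since `a ≤ 1`. As `a > 0` up to the
blow-up, `w` is semiconcave there and its slopes are bounded below, so `w` minus the primitive has
an interior minimum, a contradiction. Reflection gives the other sign.

The bound makes supersolutions compact. Hence the critical level itself has a supersolution
(`exists_supersolution_of_forall_lt`), and Perron's method gives a supersolution that solves the
equation off one point (`exists_perron`). Sending that point to infinity yields a solution
(`exists_solution`). It is `C²` where `a > 0` everywhere, because it is then semiconcave and
semiconvex on bounded intervals (`contDiff_two_of_solution`). Comparing a Lipschitz supersolution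
with a flat concave parabola bounds the critical value from below (`SupersolutionOn.le_level`).

The second summand of `K` alone gives `l + 1/α₀ = α₀ K ^ γ`; the first only makes the inequality
strict. So `C = 1` works. -/

namespace ViscousHJ
open Set Filter Topology

/-! ### Viscosity inequalities tested by parabolas. -/

/-- The parabola with slope `p` and second derivative `b` at `z` touches `w` from below at `z`. -/
def IsLowerJet (w : ℝ → ℝ) (z p b : ℝ) : Prop :=
  IsLocalMin (fun x => w x - (p * (x - z) + b / 2 * (x - z) ^ 2)) z

/-- The supersolution inequality for all parabolas touching `w` from below at points of `s`. -/
def SupersolutionOn (a : ℝ → ℝ) (G : ℝ → ℝ → ℝ) (l : ℝ) (w : ℝ → ℝ) (s : Set ℝ) : Prop :=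
  ∀ z ∈ s, ∀ p b, IsLowerJet w z p b → a z * b + G z p ≤ l

theorem hasDerivAt_parabola (p b z x : ℝ) :
    HasDerivAt (fun x => p * (x - z) + b / 2 * (x - z) ^ 2) (p + b * (x - z)) x := by
  have h1 : HasDerivAt (fun x : ℝ => x - z) 1 x := (hasDerivAt_id x).sub_const z
  have h := (h1.const_mul p).add ((h1.pow 2).const_mul (b / 2))
  refine h.congr_deriv ?_
  norm_num
  ring

theorem hasDerivAt_parabola_slope (p b z x : ℝ) :
    HasDerivAt (fun x => p + b * (x - z)) b x := by
  have h1 : HasDerivAt (fun x : ℝ => x - z) 1 x := (hasDerivAt_id x).sub_const z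
  simpa using (h1.const_mul b).const_add p

theorem deriv_parabola (p b z : ℝ) :
    deriv (fun x => p * (x - z) + b / 2 * (x - z) ^ 2) = fun x => p + b * (x - z) :=
  funext fun x => (hasDerivAt_parabola p b z x).deriv

theorem isLowerJet_of_isLocalMin {w φ g : ℝ → ℝ} {z b b' : ℝ}
    (hφ : ∀ᶠ x in 𝓝 z, HasDerivAt φ (g x) x) (hg : HasDerivAt g b z)
    (h : IsLocalMin (fun x => w x - φ x) z) (hb : b' < b) : IsLowerJet w z (g z) b' := by
  set q : ℝ → ℝ := fun x => g z * (x - z) + b' / 2 * (x - z) ^ 2 with hq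
  have hd : ∀ᶠ x in 𝓝 z, HasDerivAt (fun x => φ x - q x) (g x - (g z + b' * (x - z))) x := by
    filter_upwards [hφ] with x hx
    exact hx.sub (hasDerivAt_parabola _ _ _ _)
  have he : deriv (fun x => φ x - q x) =ᶠ[𝓝 z] fun x => g x - (g z + b' * (x - z)) := by
    filter_upwards [hd] with x hx using hx.deriv
  have hmin : IsLocalMin (fun x => φ x - q x) z := by
    apply isLocalMin_of_deriv_deriv_pos
    · rw [he.deriv_eq, (hg.fun_sub (hasDerivAt_parabola_slope _ _ _ _)).deriv]
      linarith
    · rw [he.eq_of_nhds]; simp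
    · exact hd.self_of_nhds.continuousAt
  have := h.add hmin
  unfold IsLowerJet
  refine this.congr (Eventually.of_forall fun x => ?_)
  simp [hq]

/-- Lowering the second derivative of the test function slightly puts a parabola below it; then `b'`
tends to `b`. The test function needs a second derivative only at `z`, which suits primitives of
barriers. -/
theorem SupersolutionOn.le_of_isLocalMin {a : ℝ → ℝ} {G : ℝ → ℝ → ℝ} {l : ℝ} {w : ℝ → ℝ}
    {s : Set ℝ} (hw : SupersolutionOn a G l w s) {φ g : ℝ → ℝ} {z b : ℝ} (hz : z ∈ s)
    (hφ : ∀ᶠ x in 𝓝 z, HasDerivAt φ (g x) x) (hg : HasDerivAt g b z)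
    (h : IsLocalMin (fun x => w x - φ x) z) : a z * b + G z (g z) ≤ l := by
  have key : ∀ b' < b, a z * b' + G z (g z) ≤ l := fun b' hb' =>
    hw z hz _ _ (isLowerJet_of_isLocalMin hφ hg h hb')
  have hc : Tendsto (fun b' => a z * b' + G z (g z)) (𝓝[<] b) (𝓝 (a z * b + G z (g z))) :=
    ((continuous_const.mul continuous_id).add continuous_const).continuousWithinAt
  exact le_of_tendsto hc (by filter_upwards [self_mem_nhdsWithin] with b' hb' using key b' hb')

theorem eventually_hasDerivAt_of_contDiff {φ : ℝ → ℝ} (hφ : ContDiff ℝ 2 φ) (z : ℝ) :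
    (∀ᶠ x in 𝓝 z, HasDerivAt φ (deriv φ x) x) ∧ HasDerivAt (deriv φ) (deriv (deriv φ) z) z := by
  have h2 : ContDiff ℝ 1 (deriv φ) := by
    have : ContDiff ℝ (1 + 1) φ := by simpa [one_add_one_eq_two] using hφ
    exact (contDiff_succ_iff_deriv.1 this).2.2
  exact ⟨Eventually.of_forall fun x => (hφ.differentiable (by norm_num) x).hasDerivAt,
    (h2.differentiable (by norm_num) z).hasDerivAt⟩

theorem isViscositySupersolution_iff {a : ℝ → ℝ} {G : ℝ → ℝ → ℝ} {l : ℝ} {w : ℝ → ℝ} :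
    IsViscositySupersolution a G l w ↔ Continuous w ∧ SupersolutionOn a G l w univ := by
  refine and_congr_right fun _ => ⟨fun h z _ p b hj => ?_, fun h φ z hφ hj => ?_⟩
  · have := h (fun x => p * (x - z) + b / 2 * (x - z) ^ 2) z (by fun_prop) hj
    rw [deriv_parabola, (hasDerivAt_parabola_slope p b z z).deriv] at this
    simpa using this
  · obtain ⟨h1, h2⟩ := eventually_hasDerivAt_of_contDiff hφ z
    exact h.le_of_isLocalMin (mem_univ z) h1 h2 hj

/-- The change `u ↦ -u` lets a single theory of supersolutions serve for both inequalities. -/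
theorem isViscositySubsolution_iff {a : ℝ → ℝ} {G : ℝ → ℝ → ℝ} {l : ℝ} {u : ℝ → ℝ} :
    IsViscositySubsolution a G l u ↔
      Continuous u ∧ SupersolutionOn a (fun x p => -G x (-p)) (-l) (fun x => -u x) univ := by
  rw [← continuous_neg_iff (f := u)]
  change _ ↔ Continuous (fun x => -u x) ∧ _
  rw [← isViscositySupersolution_iff]
  unfold IsViscositySubsolution IsViscositySupersolution
  rw [show Continuous (fun x => -u x) ↔ Continuous u from continuous_neg_iff]
  refine and_congr_right fun _ => ⟨fun h φ z hφ hj => ?_, fun h φ z hφ hj => ?_⟩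
  · have := h (fun x => -φ x) z hφ.neg (by
      refine hj.neg.congr (Eventually.of_forall fun x => ?_); simp; ring)
    simp only [deriv.fun_neg'] at this
    linarith
  · have := h (fun x => -φ x) z hφ.neg (by
      refine hj.neg.congr (Eventually.of_forall fun x => ?_); simp; ring)
    simp only [deriv.fun_neg', neg_neg] at this
    linarith

theorem SupersolutionOn.mono_level {a : ℝ → ℝ} {G : ℝ → ℝ → ℝ} {l l' : ℝ} {w : ℝ → ℝ}
    {s : Set ℝ} (hw : SupersolutionOn a G l w s) (h : l ≤ l') : SupersolutionOn a G l' w s :=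
  fun z hz p b hj => (hw z hz p b hj).trans h

theorem SupersolutionOn.add_const {a : ℝ → ℝ} {G : ℝ → ℝ → ℝ} {l : ℝ} {w : ℝ → ℝ}
    {s : Set ℝ} (hw : SupersolutionOn a G l w s) (k : ℝ) :
    SupersolutionOn a G l (fun x => w x + k) s := by
  intro z hz p b hj
  refine hw z hz p b ?_
  unfold IsLowerJet at *
  filter_upwards [hj] with x hx
  linarith

theorem IsLowerJet.reflect {w : ℝ → ℝ} {z p b : ℝ} (h : IsLowerJet (fun x => w (-x)) z p b) :
    IsLowerJet w (-z) (-p) b := by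
  have hc : Tendsto (fun x : ℝ => -x) (𝓝 (-z)) (𝓝 z) := by
    simpa using (continuous_neg.tendsto (-z))
  have := hc.eventually h
  unfold IsLowerJet
  filter_upwards [this] with x hx
  simp only [neg_neg] at hx
  calc _ = w (-z) - (p * (z - z) + b / 2 * (z - z) ^ 2) := by ring
    _ ≤ _ := hx
    _ = _ := by ring

theorem SupersolutionOn.reflect {a : ℝ → ℝ} {G : ℝ → ℝ → ℝ} {l : ℝ} {w : ℝ → ℝ}
    (hw : SupersolutionOn a G l w univ) :
    SupersolutionOn (fun x => a (-x)) (fun x p => G (-x) (-p)) l (fun x => w (-x)) univ :=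
  fun z _ p b hj => hw (-z) (mem_univ _) (-p) b hj.reflect

/-! ### Semiconcavity and one-sided slope bounds. -/

/-- A continuous function which no strictly concave parabola touches from above is convex. -/
theorem convexOn_of_forall_not_isLocalMax {h : ℝ → ℝ} {s : Set ℝ} (hs : Convex ℝ s)
    (hc : ContinuousOn h s)
    (H : ∀ z ∈ interior s, ∀ p c, c < 0 →
      ¬ IsLocalMax (fun x => h x - (p * (x - z) + c / 2 * (x - z) ^ 2)) z) :
    ConvexOn ℝ s h := by
  refine LinearOrder.convexOn_of_lt hs fun x hx y hy hxy α β hα hβ hαβ => ?_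
  by_contra! hlt
  set z := α • x + β • y with hz
  simp only [smul_eq_mul] at hz hlt
  have hxz : x < z := by
    have : z - x = β * (y - x) := by grind
    nlinarith [mul_pos hβ (sub_pos.2 hxy)]
  have hzy : z < y := by
    have : y - z = α * (y - x) := by grind
    nlinarith [mul_pos hα (sub_pos.2 hxy)]
  have hsub : Icc x y ⊆ s := hs.ordConnected.out hx hy
  set m := (h y - h x) / (y - x) with hm
  have hyx : 0 < y - x := sub_pos.2 hxy
  have hmy : m * (y - x) = h y - h x := by rw [hm]; field_simp
  have hgap : 0 < h z - (h x + m * (z - x)) := by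
    have h1 : z - x = β * (y - x) := by grind
    have : h x + m * (z - x) = α * h x + β * h y := by
      rw [h1, show m * (β * (y - x)) = β * (m * (y - x)) by ring, hmy]; grind
    linarith
  -- The chord is raised by a concave parabola vanishing at both ends and still below `h` at `z`;
  -- the difference then has an interior maximum.
  obtain ⟨ε, hε, hε'⟩ : ∃ ε > 0, ε * ((z - x) * (y - z)) < h z - (h x + m * (z - x)) := by
    have hp : 0 < (z - x) * (y - z) := mul_pos (sub_pos.2 hxz) (sub_pos.2 hzy)
    refine ⟨(h z - (h x + m * (z - x))) / 2 / ((z - x) * (y - z)), by positivity, ?_⟩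
    rw [div_mul_cancel₀ _ hp.ne']
    linarith
  set k : ℝ → ℝ := fun t => h t - (h x + m * (t - x) + ε * ((t - x) * (y - t))) with hk
  have hkc : ContinuousOn k (Icc x y) := by
    refine (hc.mono hsub).sub (Continuous.continuousOn ?_)
    fun_prop
  obtain ⟨t, ht, htm⟩ := isCompact_Icc.exists_isMaxOn ⟨x, left_mem_Icc.2 hxy.le⟩ hkc
  have hkz : 0 < k z := by simp only [hk]; linarith
  have hkt : 0 < k t := lt_of_lt_of_le hkz (htm ⟨hxz.le, hzy.le⟩)
  have hkx : k x = 0 := by simp [hk]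
  have hky : k y = 0 := by simp only [hk]; linarith
  have htx : x < t := lt_of_le_of_ne ht.1 (by rintro rfl; linarith)
  have hty : t < y := lt_of_le_of_ne ht.2 (by rintro rfl; linarith)
  have hloc : IsLocalMax k t := htm.isLocalMax (Icc_mem_nhds htx hty)
  refine H t (interior_mono hsub (by rw [interior_Icc]; exact ⟨htx, hty⟩))
    (m + ε * (x + y - 2 * t)) (-2 * ε) (by linarith) ?_
  filter_upwards [hloc] with r hr
  simp only [hk] at hr
  nlinarith

theorem convexOn_parabola_sub_of_forall_isLowerJet {w : ℝ → ℝ} {s : Set ℝ} {N : ℝ}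
    (hs : Convex ℝ s) (hc : ContinuousOn w s)
    (h : ∀ z ∈ interior s, ∀ p b, IsLowerJet w z p b → b ≤ N) :
    ConvexOn ℝ s (fun x => N / 2 * x ^ 2 - w x) := by
  refine convexOn_of_forall_not_isLocalMax hs
    ((Continuous.continuousOn (by fun_prop)).sub hc) fun z hz p c hc0 hmax => ?_
  have : IsLowerJet w z (N * z - p) (N - c) := by
    unfold IsLowerJet
    filter_upwards [hmax] with x hx
    nlinarith
  linarith [h z hz _ _ this]

/-- Chord slopes of a convex function increase, so those left of `x₁` are at most the slope over
`[x₁, e]`; the room beyond `x₁` is essential. -/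
theorem exists_slope_lower_bound {w : ℝ → ℝ} {N x₀ x₁ e : ℝ}
    (h : ConvexOn ℝ (Icc x₀ e) (fun x => N / 2 * x ^ 2 - w x)) (h₁ : x₁ < e) :
    ∃ L, ∀ y x, x₀ ≤ y → y < x → x ≤ x₁ → -L * (x - y) ≤ w x - w y := by
  set k : ℝ → ℝ := fun x => N / 2 * x ^ 2 - w x with hk
  set S := (k e - k x₁) / (e - x₁) with hS
  refine ⟨S + |N| * (|x₀| + |e|), fun y x hy hyx hx => ?_⟩
  have hsl : (k x - k y) / (x - y) ≤ S := by
    have hxe : e ∈ Icc x₀ e := ⟨by linarith, le_rfl⟩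
    have hyI : y ∈ Icc x₀ e := ⟨hy, by linarith⟩
    rcases hx.eq_or_lt with rfl | hlt
    · exact h.slope_mono_adjacent hyI hxe hyx h₁
    · exact (h.slope_mono_adjacent hyI ⟨by linarith, h₁.le⟩ hyx hlt).trans
        (h.slope_mono_adjacent (y := x₁) ⟨by linarith, by linarith⟩ hxe hlt h₁)
  rw [div_le_iff₀ (sub_pos.2 hyx)] at hsl
  have hb : ∀ t, x₀ ≤ t → t ≤ e → |t| ≤ |x₀| + |e| := fun t h1 h2 =>
    (abs_le_max_abs_abs h1 h2).trans (max_le (by linarith [abs_nonneg e]) (by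
      linarith [abs_nonneg x₀]))
  have hN : |N / 2 * (x + y)| ≤ |N| * (|x₀| + |e|) := by
    rw [abs_mul, abs_div, abs_two]
    have h1 := hb x (by linarith) (by linarith)
    have h2 := hb y hy (by linarith)
    have h3 := abs_add_le x y
    nlinarith [abs_nonneg N]
  have hN' := neg_le_of_abs_le hN
  have : w x - w y = N / 2 * (x + y) * (x - y) - (k x - k y) := by simp only [hk]; ring
  rw [this]
  nlinarith [mul_le_mul_of_nonneg_right hN' (sub_pos.2 hyx).le]

/-! ### The Lipschitz estimate by blow-up barriers. -/

/-- A supersolution cannot be steeper at `x₀` than the slope `g` of a strict local subsolution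
whose slope at `x₁` is below the slopes of `w`. -/
theorem SupersolutionOn.false_of_barrier {a : ℝ → ℝ} {G : ℝ → ℝ → ℝ} {l : ℝ} {w g g' : ℝ → ℝ}
    {x₂ x₀ x₁ q b L : ℝ} (hw : SupersolutionOn a G l w univ) (hwc : Continuous w)
    (hj : IsLowerJet w x₀ q b) (h₂ : x₂ < x₀) (h₁ : x₀ < x₁)
    (hgc : ContinuousOn g (Icc x₂ x₁))
    (hg : ∀ x ∈ Ioo x₂ x₁, HasDerivAt g (g' x) x ∧ l < a x * g' x + G x (g x))
    (hq : q < g x₀) (hL : g x₁ < -L)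
    (hslope : ∀ y, x₀ ≤ y → y < x₁ → -L * (x₁ - y) ≤ w x₁ - w y) : False := by
  have h₂₁ : x₂ ≤ x₁ := (h₂.trans h₁).le
  -- Extending `g` by constants gives a primitive `Φ` that is `C¹` on the whole line.
  set f : ℝ → ℝ := IccExtend h₂₁ ((Icc x₂ x₁).domRestrict g) with hf
  have hfc : Continuous f := hgc.domRestrict.Icc_extend'
  have hfg : ∀ x ∈ Icc x₂ x₁, f x = g x := fun x hx => by
    rw [hf, IccExtend_of_mem _ _ hx]; rfl
  set Φ : ℝ → ℝ := fun x => ∫ t in x₀..x, f t with hΦ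
  have hΦd : ∀ x, HasDerivAt Φ (f x) x := fun x =>
    intervalIntegral.integral_hasDerivAt_right (hfc.intervalIntegrable _ _)
      (hfc.stronglyMeasurableAtFilter _ _) hfc.continuousAt
  have hΦc : Continuous Φ := continuous_iff_continuousAt.2 fun x => (hΦd x).continuousAt
  -- left of `x₀` the barrier lies strictly below `w`
  obtain ⟨x₃, hx₃, hx₃', hleft⟩ : ∃ x₃, x₂ < x₃ ∧ x₃ < x₀ ∧ w x₀ - Φ x₀ < w x₃ - Φ x₃ := by
    have hd : HasDerivAt (fun x => Φ x - (q * (x - x₀) + b / 2 * (x - x₀) ^ 2))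
        (f x₀ - (q + b * (x₀ - x₀))) x₀ := (hΦd x₀).sub (hasDerivAt_parabola q b x₀ x₀)
    have hpos : 0 < f x₀ - (q + b * (x₀ - x₀)) := by
      rw [hfg x₀ ⟨h₂.le, h₁.le⟩]; simpa using hq
    have h1 : ∀ᶠ x in 𝓝[<] x₀, Φ x - (q * (x - x₀) + b / 2 * (x - x₀) ^ 2) <
        Φ x₀ - (q * (x₀ - x₀) + b / 2 * (x₀ - x₀) ^ 2) := by
      have h2 := (hasDerivAt_iff_tendsto_slope_left_right.1 hd).1
      filter_upwards [h2.eventually (lt_mem_nhds hpos), self_mem_nhdsWithin] with x hx hx'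
      rw [slope_def_field] at hx
      have : x - x₀ < 0 := sub_neg.2 hx'
      by_contra! hcon
      exact hx.not_ge (div_nonpos_of_nonneg_of_nonpos (sub_nonneg.2 hcon) this.le)
    have h3 : ∀ᶠ x in 𝓝[<] x₀, x₂ < x := nhdsWithin_le_nhds (lt_mem_nhds h₂)
    have h4 := nhdsWithin_le_nhds (s := Iio x₀) hj
    obtain ⟨x, ⟨⟨hx1, hx3⟩, hx4⟩, hx5⟩ := (((h1.and h3).and h4).and self_mem_nhdsWithin).exists
    refine ⟨x, hx3, hx5, ?_⟩
    simp only at hx4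
    linarith
  have hx₃₁ : x₃ < x₁ := hx₃'.trans h₁
  -- just left of `x₁` the function `w - Φ` is below its value at `x₁`
  obtain ⟨x₄, hx₄, hx₄', hright⟩ : ∃ x₄, x₀ < x₄ ∧ x₄ < x₁ ∧ w x₄ - Φ x₄ < w x₁ - Φ x₁ := by
    have hneg : f x₁ < -L := by rwa [hfg x₁ ⟨h₂₁, le_rfl⟩]
    have h2 := (hasDerivAt_iff_tendsto_slope_left_right.1 (hΦd x₁)).1
    have h3 : ∀ᶠ x in 𝓝[<] x₁, x₀ < x := nhdsWithin_le_nhds (lt_mem_nhds h₁)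
    obtain ⟨x, ⟨hx1, hx2⟩, hx3⟩ :=
      (((h2.eventually (gt_mem_nhds hneg)).and h3).and self_mem_nhdsWithin).exists
    refine ⟨x, hx2, hx3, ?_⟩
    rw [slope_def_field] at hx1
    have : x - x₁ < 0 := sub_neg.2 hx3
    have h4 := (div_lt_iff_of_neg this).1 hx1
    have h5 := hslope x hx2.le hx3
    linarith
  obtain ⟨z, hz, hzm⟩ := isCompact_Icc.exists_isMinOn (f := fun x => w x - Φ x)
    (nonempty_Icc.2 hx₃₁.le) (hwc.sub hΦc).continuousOn
  have hz₃ : x₃ < z := lt_of_le_of_ne hz.1 (by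
    rintro rfl
    have := hzm (⟨hx₃'.le, h₁.le⟩ : x₀ ∈ Icc x₃ x₁)
    simp only [mem_ofPred_eq] at this
    linarith)
  have hz₁ : z < x₁ := lt_of_le_of_ne hz.2 (by
    rintro rfl
    have := hzm (⟨(hx₃'.trans hx₄).le, hx₄'.le⟩ : x₄ ∈ Icc x₃ z)
    simp only [mem_ofPred_eq] at this
    linarith)
  have hzI : z ∈ Ioo x₂ x₁ := ⟨hx₃.trans hz₃, hz₁⟩
  obtain ⟨hgz, hlt⟩ := hg z hzI
  have hloc := hzm.isLocalMin (Icc_mem_nhds hz₃ hz₁)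
  have hfz : HasDerivAt f (g' z) z := hgz.congr_of_eventuallyEq (by
    filter_upwards [Ioo_mem_nhds hzI.1 hzI.2] with x hx using hfg x (Ioo_subset_Icc_self hx))
  have := hw.le_of_isLocalMin (mem_univ z) (Eventually.of_forall hΦd) hfz hloc
  rw [hfg z (Ioo_subset_Icc_self hzI)] at this
  linarith

/-- Coercivity of `G` above the level `l`. -/
structure CoerciveAbove (G : ℝ → ℝ → ℝ) (l M c D : ℝ) : Prop where
  pos : 0 < M
  cpos : 0 < c
  lower : ∀ x p, -D ≤ G x p
  growth : ∀ x p, M ≤ |p| → l + c * p ^ 2 < G x p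

/-- The barrier slope is `-1/r`: the substitution turns the Riccati inequality into the linear one
`-c ≤ a r'`, and blow-up into a zero of `r`. -/
theorem SupersolutionOn.false_of_blowup {a : ℝ → ℝ} {G : ℝ → ℝ → ℝ} {l M c D : ℝ} {w r r' : ℝ → ℝ}
    {x₀ x₁ e q b : ℝ} (hG : CoerciveAbove G l M c D) (hac : Continuous a)
    (hw : SupersolutionOn a G l w univ) (hwc : Continuous w)
    (hj : IsLowerJet w x₀ q b) (h₁ : x₀ < x₁) (he : x₁ < e) (hpos : ∀ x ∈ Ico x₀ e, 0 < a x)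
    (hr : ∀ x < e, HasDerivAt r (r' x) x ∧ -c ≤ a x * r' x)
    (hr_pos : ∀ x < x₁, 0 < r x) (hr_le : ∀ x, x₀ ≤ x → x ≤ x₁ → r x ≤ r x₀)
    (hr₁ : r x₁ = 0) (hrM : r x₀ < 1 / M) (hrq : 1 / r x₀ < -q) : False := by
  have hM := hG.pos
  -- local semiconcavity
  obtain ⟨e', he', he''⟩ := exists_between he
  obtain ⟨y, hy, hymin⟩ := (isCompact_Icc (a := x₀) (b := e')).exists_isMinOn
    (nonempty_Icc.2 (h₁.trans he').le) hac.continuousOn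
  have hay : 0 < a y := hpos y ⟨hy.1, hy.2.trans_lt he''⟩
  -- On `[x₀, e']` one has `a ≥ a y > 0` and `G ≥ -D`, so the equation bounds second derivatives
  -- from above.
  have hconv := convexOn_parabola_sub_of_forall_isLowerJet (w := w) (s := Icc x₀ e')
    (N := |l + D| / a y) (convex_Icc _ _) hwc.continuousOn (by
      intro z hz p b hzj
      have hz' := interior_subset hz
      have haz : a y ≤ a z := hymin hz'
      have h1 := hw z (mem_univ z) p b hzj
      have h2 := hG.lower z p
      have h3 := le_abs_self (l + D)
      rw [le_div_iff₀ hay]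
      rcases le_or_gt b 0 with hb | hb
      · nlinarith [abs_nonneg (l + D)]
      · nlinarith)
  obtain ⟨L, hL⟩ := exists_slope_lower_bound hconv he'
  have hrc : ∀ x < e, ContinuousAt r x := fun x hx => (hr x hx).1.continuousAt
  obtain ⟨x₂, hx₂, hx₂'⟩ : ∃ x₂ < x₀, ∀ x, x₂ ≤ x → x ≤ x₀ → r x < 1 / M := by
    have h1 : ∀ᶠ x in 𝓝 x₀, r x < 1 / M := (hrc x₀ (h₁.trans he)).eventually (gt_mem_nhds hrM)
    obtain ⟨δ, hδ, h2⟩ := Metric.eventually_nhds_iff.1 h1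
    refine ⟨x₀ - δ / 2, by linarith, fun x hx hx' => h2 ?_⟩
    rw [Real.dist_eq, abs_lt]
    constructor <;> linarith
  obtain ⟨x₃, hx₃, hx₃', hrx₃⟩ : ∃ x₃, x₀ < x₃ ∧ x₃ < x₁ ∧ r x₃ < 1 / (|L| + 1) := by
    have h1 : ∀ᶠ x in 𝓝[<] x₁, r x < 1 / (|L| + 1) := nhdsWithin_le_nhds
      ((hrc x₁ he).eventually (gt_mem_nhds (by rw [hr₁]; positivity)))
    have h2 : ∀ᶠ x in 𝓝[<] x₁, x₀ < x := nhdsWithin_le_nhds (lt_mem_nhds h₁)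
    obtain ⟨x, ⟨hx1, hx2⟩, hx3⟩ := ((h1.and h2).and self_mem_nhdsWithin).exists
    exact ⟨x, hx2, hx3, hx1⟩
  have hder : ∀ x < x₁, HasDerivAt (fun x => -(r x)⁻¹) (r' x / r x ^ 2) x := fun x hx => by
    refine ((hr x (hx.trans he)).1.fun_inv (hr_pos x hx).ne').neg.congr_deriv ?_
    ring
  refine hw.false_of_barrier (g := fun x => -(r x)⁻¹) (g' := fun x => r' x / r x ^ 2) (L := L)
    hwc hj hx₂ hx₃ (fun x hx => (hder x (hx.2.trans_lt hx₃')).continuousAt.continuousWithinAt)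
    (fun x hx => ⟨hder x (hx.2.trans hx₃'), ?_⟩) ?_ ?_
    (fun y hy hy' => hL y x₃ hy hy' hx₃'.le)
  · have hxx : x < x₁ := hx.2.trans hx₃'
    have hrx := hr_pos x hxx
    have hrM' : r x < 1 / M := by
      rcases le_or_gt x x₀ with h | h
      · exact hx₂' x hx.1.le h
      · exact (hr_le x h.le hxx.le).trans_lt hrM
    have hMr : M ≤ (r x)⁻¹ := by
      rw [le_inv_comm₀ hM hrx]; rw [one_div] at hrM'; exact hrM'.le
    have h1 := hG.growth x (-(r x)⁻¹) (by
      rw [abs_neg, abs_of_pos (inv_pos.2 hrx)]; exact hMr)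
    have h2 := (hr x (hxx.trans he)).2
    have h3 : a x * (r' x / r x ^ 2) = a x * r' x * (-(r x)⁻¹) ^ 2 := by
      field_simp
    rw [h3]
    nlinarith [mul_le_mul_of_nonneg_right h2 (sq_nonneg (-(r x)⁻¹))]
  · rw [one_div] at hrq; linarith
  · have hrx := hr_pos x₃ hx₃'
    have h1 : |L| + 1 < (r x₃)⁻¹ := by
      rw [lt_inv_comm₀ (by positivity) hrx]; simpa using hrx₃
    linarith [le_abs_self L]

/-- Diffusion coefficients in `[0, 1]` with Lipschitz square root. -/
structure DegenerateCoeff (κ : ℝ) (a : ℝ → ℝ) : Prop where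
  kpos : 0 < κ
  nonneg : ∀ x, 0 ≤ a x
  le_one : ∀ x, a x ≤ 1
  sqrt_lip : ∀ x y, |√(a x) - √(a y)| ≤ κ * |x - y|

theorem DegenerateCoeff.reflect {κ : ℝ} {a : ℝ → ℝ} (h : DegenerateCoeff κ a) :
    DegenerateCoeff κ (fun x => a (-x)) :=
  ⟨h.kpos, fun x => h.nonneg _, fun x => h.le_one _, fun x y => by
    refine (h.sqrt_lip _ _).trans_eq ?_
    rw [← abs_neg]; congr 2; ring⟩

theorem DegenerateCoeff.continuous {κ : ℝ} {a : ℝ → ℝ} (h : DegenerateCoeff κ a) :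
    Continuous a := by
  have h1 : Continuous fun x => √(a x) :=
    (LipschitzWith.of_dist_le_mul (K := κ.toNNReal) fun x y => by
      simpa [Real.dist_eq, h.kpos.le] using h.sqrt_lip x y).continuous
  have h2 : a = fun x => √(a x) ^ 2 := funext fun x => (Real.sq_sqrt (h.nonneg x)).symm
  rw [h2]
  exact h1.pow 2

theorem DegenerateCoeff.le_sq_of_zero {κ : ℝ} {a : ℝ → ℝ} (h : DegenerateCoeff κ a) {d : ℝ}
    (hd : a d = 0) (x : ℝ) : a x ≤ κ ^ 2 * (d - x) ^ 2 := by
  have h1 := h.sqrt_lip x d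
  rw [hd, Real.sqrt_zero, sub_zero, abs_of_nonneg (Real.sqrt_nonneg _)] at h1
  calc a x = √(a x) ^ 2 := (Real.sq_sqrt (h.nonneg x)).symm
    _ ≤ (κ * |x - d|) ^ 2 := by gcongr
    _ = _ := by rw [mul_pow, sq_abs]; ring

theorem CoerciveAbove.reflect {G : ℝ → ℝ → ℝ} {l M c D : ℝ} (h : CoerciveAbove G l M c D) :
    CoerciveAbove (fun x p => G (-x) (-p)) l M c D :=
  ⟨h.pos, h.cpos, fun x p => h.lower _ _, fun x p hp => by
    simpa using h.growth (-x) (-p) (by rwa [abs_neg])⟩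

theorem SupersolutionOn.neg_le_slope {a : ℝ → ℝ} {G : ℝ → ℝ → ℝ} {κ l M c D : ℝ} {w : ℝ → ℝ}
    {x₀ q b : ℝ} (hG : CoerciveAbove G l M c D) (ha : DegenerateCoeff κ a)
    (hw : SupersolutionOn a G l w univ) (hwc : Continuous w)
    (hj : IsLowerJet w x₀ q b) : -M ≤ q := by
  by_contra! hq
  have hM := hG.pos
  have hc := hG.cpos
  have hκ := ha.kpos
  obtain ⟨M₁, hM₁, hM₁q⟩ := exists_between (show M < -q by linarith)
  have hM₁p : 0 < M₁ := hM.trans hM₁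
  have hrM : 1 / M₁ < 1 / M := one_div_lt_one_div_of_lt hM hM₁
  -- At a zero of `a` the inequality reads `G x₀ q ≤ l`, which coercivity excludes.
  have ha0 : a x₀ ≠ 0 := fun h0 => by
    have h1 := hw x₀ (mem_univ _) q b hj
    have h2 := hG.growth x₀ q (by rw [abs_of_neg (by linarith)]; linarith)
    rw [h0] at h1
    nlinarith [sq_nonneg q]
  by_cases hZ : ∃ d, x₀ ≤ d ∧ a d = 0
  · obtain ⟨d, hd⟩ : ∃ d, IsLeast {x | x₀ ≤ x ∧ a x = 0} d := by
      have hcl : IsClosed {x | x₀ ≤ x ∧ a x = 0} :=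
        isClosed_Ici.inter (isClosed_singleton.preimage ha.continuous)
      exact ⟨_, hcl.isLeast_csInf hZ ⟨x₀, fun x hx => hx.1⟩⟩
    have hd₀ : x₀ < d := lt_of_le_of_ne hd.1.1 (by rintro rfl; exact ha0 hd.1.2)
    have hpos : ∀ x ∈ Ico x₀ d, 0 < a x := fun x hx =>
      lt_of_le_of_ne (ha.nonneg x) fun h => absurd (hd.2 ⟨hx.1, h.symm⟩) (not_le.2 hx.2)
    -- Chosen so that `r x₀ = 1 / M₁`; the zero `d - 1 / T` of `r` then lies strictly between `x₀`
    -- and `d`.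
    set T := 1 / (d - x₀) + κ ^ 2 / (c * M₁) with hT
    have hd0' : 0 < d - x₀ := sub_pos.2 hd₀
    have hTp : 1 / (d - x₀) < T := by rw [hT]; linarith [show 0 < κ ^ 2 / (c * M₁) by positivity]
    have hT0 : 0 < T := lt_trans (by positivity) hTp
    set r : ℝ → ℝ := fun x => c / κ ^ 2 * (T - (d - x)⁻¹) with hr
    have hrx₀ : r x₀ = 1 / M₁ := by
      simp only [hr, hT]; field_simp; ring
    refine hw.false_of_blowup (r := r) (r' := fun x => -(c / κ ^ 2 * ((d - x)⁻¹) ^ 2))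
      (x₁ := d - 1 / T) hG ha.continuous hwc hj ?_ ?_ hpos ?_ ?_ ?_ ?_ ?_ ?_
    · have := (one_div_lt hd0' hT0).1 hTp
      linarith
    · linarith [show 0 < 1 / T by positivity]
    · intro x hx
      have hdx : 0 < d - x := sub_pos.2 hx
      constructor
      · have h1 : HasDerivAt (fun x => d - x) (-1) x := (hasDerivAt_id x).const_sub d
        refine (((h1.fun_inv hdx.ne').const_sub T).const_mul (c / κ ^ 2)).congr_deriv ?_
        field_simp
      · have h1 := ha.le_sq_of_zero hd.1.2 x
        have h2 : a x * (c / κ ^ 2 * ((d - x)⁻¹) ^ 2) ≤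
            κ ^ 2 * (d - x) ^ 2 * (c / κ ^ 2 * ((d - x)⁻¹) ^ 2) := by gcongr
        have h3 : κ ^ 2 * (d - x) ^ 2 * (c / κ ^ 2 * ((d - x)⁻¹) ^ 2) = c := by field_simp
        linarith
    · intro x hx
      have h1 : T⁻¹ < d - x := by rw [one_div] at hx; linarith
      have h2 : (d - x)⁻¹ < T := inv_lt_of_inv_lt₀ hT0 h1
      have : 0 < c / κ ^ 2 := by positivity
      exact mul_pos this (by linarith)
    · intro x hx hx'
      have hdx : 0 < d - x := by linarith [show 0 < 1 / T by positivity]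
      have : (d - x₀)⁻¹ ≤ (d - x)⁻¹ := inv_anti₀ hdx (by linarith)
      simp only [hr]
      gcongr
    · simp [hr]
    · rw [hrx₀]; exact hrM
    · rw [hrx₀]; simpa using hM₁q
  · push Not at hZ
    set x₁ := x₀ + 1 / (c * M₁) with hx₁
    have hlt : x₀ < x₁ := by rw [hx₁]; linarith [show 0 < 1 / (c * M₁) by positivity]
    have hrx₀ : c * (x₁ - x₀) = 1 / M₁ := by rw [hx₁]; field_simp; ring
    refine hw.false_of_blowup (r := fun x => c * (x₁ - x)) (r' := fun _ => -c)
      (x₁ := x₁) (e := x₁ + 1) hG ha.continuous hwc hj hlt (by linarith)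
      (fun x hx => lt_of_le_of_ne (ha.nonneg x) (hZ x hx.1).symm) ?_ ?_ ?_ ?_ ?_ ?_
    · intro x _
      refine ⟨?_, by nlinarith [ha.le_one x]⟩
      simpa using ((hasDerivAt_id x).const_sub x₁).const_mul c
    · exact fun x hx => mul_pos hc (sub_pos.2 hx)
    · intro x hx _
      show c * (x₁ - x) ≤ c * (x₁ - x₀)
      gcongr
    · simp
    · simp only [hrx₀]; exact hrM
    · simp only [hrx₀]; simpa using hM₁q

/-- If `w` dropped too fast, a test function steeper than `-M` would touch it from below. A high
power, still small at `y`, keeps the contact away from the right end of an interval twice as long.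
-/
theorem sub_le_of_forall_neg_le_slope {w : ℝ → ℝ} {M : ℝ} (hM : 0 < M) (hwc : Continuous w)
    (h : ∀ z p b, IsLowerJet w z p b → -M ≤ p) {x y : ℝ} (hxy : x < y) :
    w x - w y ≤ M * (y - x) := by
  by_contra! hlt
  have hd : 0 < y - x := sub_pos.2 hxy
  obtain ⟨ε, hε, hε'⟩ : ∃ ε > 0, M * (y - x) + ε * (y - x + 1) < w x - w y := by
    refine ⟨(w x - w y - M * (y - x)) / 2 / (y - x + 1), by
      have : 0 < w x - w y - M * (y - x) := by linarith
      positivity, ?_⟩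
    rw [div_mul_cancel₀ _ (by positivity)]
    linarith
  obtain ⟨n, hn⟩ := pow_unbounded_of_one_lt ((w x - w (x + 2 * (y - x))) / ε)
    (show (1 : ℝ) < 2 by norm_num)
  set φ : ℝ → ℝ := fun z => -((M + ε) * (z - x) + ε * ((z - x) / (y - x)) ^ (n + 1)) with hφ
  have hφc : ContDiff ℝ 2 φ := by
    rw [hφ]; fun_prop
  have hder : ∀ z, HasDerivAt φ
      (-((M + ε) + ε * ((n + 1 : ℕ) * ((z - x) / (y - x)) ^ n * (1 / (y - x))))) z := fun z => by
    have h1 : HasDerivAt (fun z : ℝ => z - x) 1 z := (hasDerivAt_id z).sub_const x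
    have h2 := ((h1.div_const (y - x)).pow (n + 1)).const_mul ε
    have h3 := ((h1.const_mul (M + ε)).add h2).neg
    refine h3.congr_deriv ?_
    simp
  obtain ⟨z, hz, hzm⟩ := isCompact_Icc.exists_isMinOn (f := fun t => w t - φ t)
    (nonempty_Icc.2 (show x ≤ x + 2 * (y - x) by linarith))
    (hwc.sub hφc.continuous).continuousOn
  have hy : w y - φ y < w x := by
    simp only [hφ]
    rw [div_self hd.ne', one_pow]
    nlinarith
  have hzy : w z - φ z ≤ w y - φ y := hzm ⟨by linarith, by linarith⟩
  have hφx : φ x = 0 := by simp [hφ]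
  have hz₁ : x < z := lt_of_le_of_ne hz.1 (by rintro rfl; linarith)
  have hz₂ : z < x + 2 * (y - x) := lt_of_le_of_ne hz.2 (by
    rintro rfl
    rw [div_lt_iff₀ hε] at hn
    have h1 : (x + 2 * (y - x) - x) / (y - x) = 2 := by field_simp; ring
    simp only [hφ, h1] at hzy hy
    have : (2 : ℝ) ^ (n + 1) = 2 * 2 ^ n := by ring
    rw [this] at hzy
    have : 0 < (2 : ℝ) ^ n := by positivity
    nlinarith [mul_pos hε this, mul_pos hM hd, mul_pos hε hd])
  obtain ⟨h1, h2⟩ := eventually_hasDerivAt_of_contDiff hφc z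
  have hj := isLowerJet_of_isLocalMin h1 h2 (hzm.isLocalMin (Icc_mem_nhds hz₁ hz₂))
    (sub_one_lt _)
  have h3 := h _ _ _ hj
  rw [(hder z).deriv] at h3
  have h4 : 0 ≤ ((n + 1 : ℕ) : ℝ) * ((z - x) / (y - x)) ^ n * (1 / (y - x)) := by
    have : 0 < z - x := sub_pos.2 hz₁
    positivity
  nlinarith

theorem SupersolutionOn.lipschitz {a : ℝ → ℝ} {G : ℝ → ℝ → ℝ} {κ l M c D : ℝ} {w : ℝ → ℝ}
    (hG : CoerciveAbove G l M c D) (ha : DegenerateCoeff κ a)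
    (hw : SupersolutionOn a G l w univ) (hwc : Continuous w) (x y : ℝ) :
    |w x - w y| ≤ M * |x - y| := by
  have key : ∀ x y, x < y → |w x - w y| ≤ M * |x - y| := by
    intro x y hxy
    rw [abs_sub_comm x y, abs_of_pos (sub_pos.2 hxy), abs_le]
    constructor
    · have := sub_le_of_forall_neg_le_slope (w := fun x => w (-x)) hG.pos
        (hwc.comp continuous_neg) (fun z p b hj =>
          SupersolutionOn.neg_le_slope hG.reflect ha.reflect hw.reflect
            (hwc.comp continuous_neg) hj) (neg_lt_neg hxy)
      simp only [neg_neg] at this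
      linarith
    · exact sub_le_of_forall_neg_le_slope hG.pos hwc (fun z p b hj =>
        hw.neg_le_slope hG ha hwc hj) hxy
  rcases lt_trichotomy x y with h | rfl | h
  · exact key x y h
  · simp
  · rw [abs_sub_comm, abs_sub_comm x y]; exact key y x h

/-! ### Stability and compactness. -/

theorem SupersolutionOn.mono_set {a : ℝ → ℝ} {G : ℝ → ℝ → ℝ} {l : ℝ} {w : ℝ → ℝ}
    {s t : Set ℝ} (hw : SupersolutionOn a G l w s) (h : t ⊆ s) : SupersolutionOn a G l w t :=
  fun z hz p b hj => hw z (h hz) p b hj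

/-- Stability: the supersolution inequality at `z` passes to a function `m` which is approximated
at `z`, and from above near `z`, by supersolutions. -/
theorem le_of_isLowerJet_of_approx {a : ℝ → ℝ} {G : ℝ → ℝ → ℝ} {l r z p b : ℝ} {m : ℝ → ℝ}
    (ha : Continuous a) (hG : Continuous (Function.uncurry G)) (hr : 0 < r)
    (h : ∀ δ > 0, ∃ w, Continuous w ∧ SupersolutionOn a G (l + δ) w (Ioo (z - r) (z + r)) ∧
      (∀ x ∈ Ioo (z - r) (z + r), m x - δ ≤ w x) ∧ w z ≤ m z + δ)
    (hj : IsLowerJet m z p b) : a z * b + G z p ≤ l := by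
  have key : ∀ ε > 0, a z * (b - ε) + G z p ≤ l := by
    intro ε hε
    by_contra! hlt
    set F : ℝ → ℝ := fun t => a t * (b - ε) + G t (p + (b - ε) * (t - z)) with hF
    have hFc : Continuous F := by
      have : Continuous fun t => Function.uncurry G (t, p + (b - ε) * (t - z)) :=
        hG.comp (by fun_prop)
      exact (ha.mul continuous_const).add this
    have hFz : F z = a z * (b - ε) + G z p := by simp [hF]
    set γ := (F z - l) / 2 with hγ
    have hγp : 0 < γ := by rw [hγ, hFz]; linarith
    have h1 : ∀ᶠ t in 𝓝 z, l + γ < F t :=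
      hFc.continuousAt.eventually (lt_mem_nhds (by rw [hγ] at *; linarith))
    have h2 : ∀ᶠ t in 𝓝 z, t ∈ Ioo (z - r) (z + r) :=
      Ioo_mem_nhds (by linarith) (by linarith)
    obtain ⟨ρ, hρ, hball⟩ := Metric.eventually_nhds_iff.1 ((h1.and h2).and hj)
    set η := ρ / 2 with hη
    have hηp : 0 < η := by positivity
    have hin : ∀ t ∈ Icc (z - η) (z + η), dist t z < ρ := fun t ht => by
      rw [Real.dist_eq, abs_lt]; constructor <;> linarith [ht.1, ht.2]
    -- The minimum point `t` will satisfy `ε / 2 * (t - z) ^ 2 ≤ 2 * δ`, so this size of `δ` makes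
    -- it interior.
    obtain ⟨δ, hδ, hδ'⟩ : ∃ δ > 0, δ ≤ γ ∧ δ ≤ ε * η ^ 2 / 8 :=
      ⟨min γ (ε * η ^ 2 / 8), lt_min hγp (by positivity), min_le_left _ _, min_le_right _ _⟩
    obtain ⟨w, hwc, hw, hmw, hwz⟩ := h δ hδ
    set J : ℝ → ℝ := fun x => p * (x - z) + (b - ε) / 2 * (x - z) ^ 2 with hJ
    obtain ⟨t, ht, htm⟩ := isCompact_Icc.exists_isMinOn (f := fun x => w x - J x)
      (nonempty_Icc.2 (show z - η ≤ z + η by linarith))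
      (hwc.sub (by rw [hJ]; fun_prop)).continuousOn
    obtain ⟨⟨htF, htr⟩, htj⟩ := hball (hin t ht)
    have h3 : w t - J t ≤ w z - J z := htm ⟨by linarith, by linarith⟩
    have hJz : J z = 0 := by simp [hJ]
    have h4 := hmw t htr
    simp only at htj
    have h5 : ε / 2 * (t - z) ^ 2 ≤ 2 * δ := by
      simp only [hJ] at h3 hJz
      nlinarith
    have h6 : (t - z) ^ 2 < η ^ 2 := by
      have : ε * (t - z) ^ 2 < ε * η ^ 2 := by nlinarith [hδ'.2, mul_pos hε (pow_pos hηp 2)]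
      exact lt_of_mul_lt_mul_left this hε.le
    have h7 := abs_lt.1 (abs_lt_of_sq_lt_sq h6 hηp.le)
    have hloc := htm.isLocalMin (Icc_mem_nhds (by linarith) (by linarith))
    have := hw.le_of_isLocalMin htr
      (Eventually.of_forall fun x => hasDerivAt_parabola p (b - ε) z x)
      (hasDerivAt_parabola_slope p (b - ε) z t) hloc
    simp only [hF] at htF
    linarith [hδ'.1]
  have hc : Tendsto (fun ε => a z * (b - ε) + G z p) (𝓝[>] 0) (𝓝 (a z * (b - 0) + G z p)) :=
    (Continuous.continuousWithinAt (by fun_prop))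
  rw [sub_zero] at hc
  exact le_of_tendsto hc (by filter_upwards [self_mem_nhdsWithin] with ε hε using key ε hε)

theorem continuous_of_abs_sub_le {w : ℝ → ℝ} {K : ℝ} (hK : 0 ≤ K)
    (h : ∀ x y, |w x - w y| ≤ K * |x - y|) : Continuous w :=
  (LipschitzWith.of_dist_le_mul (K := K.toNNReal) fun x y => by
    simpa [Real.dist_eq, hK] using h x y).continuous

theorem eventually_forall_abs_sub_le {ι : Type*} {f : Filter ι} {F : ι → ℝ → ℝ} {u : ℝ → ℝ}
    {K : ℝ} (hK : 0 < K) (hF : ∀ n x y, |F n x - F n y| ≤ K * |x - y|)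
    (hu : ∀ x y, |u x - u y| ≤ K * |x - y|) (ht : ∀ x, Tendsto (fun n => F n x) f (𝓝 (u x)))
    {s : Set ℝ} (hs : IsCompact s) {δ : ℝ} (hδ : 0 < δ) :
    ∀ᶠ n in f, ∀ x ∈ s, |F n x - u x| ≤ δ := by
  refine hs.induction_on (p := fun s => ∀ᶠ n in f, ∀ x ∈ s, |F n x - u x| ≤ δ) (by simp)
    (fun s t hst h => h.mono fun n hn x hx => hn x (hst hx))
    (fun s t h1 h2 => by
      filter_upwards [h1, h2] with n hn1 hn2 x hx
      exact hx.elim (hn1 x) (hn2 x)) fun x _ => ?_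
  refine ⟨Metric.ball x (δ / 3 / K), mem_nhdsWithin_of_mem_nhds
    (Metric.ball_mem_nhds _ (by positivity)), ?_⟩
  have h1 : ∀ᶠ n in f, |F n x - u x| < δ / 3 := by
    have := (ht x).eventually (Metric.ball_mem_nhds (u x) (show 0 < δ / 3 by positivity))
    simpa only [Metric.mem_ball, Real.dist_eq] using this
  filter_upwards [h1] with n hn y hy
  rw [Metric.mem_ball, Real.dist_eq, lt_div_iff₀ hK] at hy
  have h2 := hF n y x
  have h3 := hu x y
  rw [abs_sub_comm x y] at h3
  calc |F n y - u y| = |(F n y - F n x) + (F n x - u x) + (u x - u y)| := by congr 1; ring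
    _ ≤ |F n y - F n x| + |F n x - u x| + |u x - u y| := abs_add_three _ _ _
    _ ≤ δ := by linarith

/-- An ultrafilter replaces the diagonal subsequence: values at each point stay in a compact
interval. Equi-Lipschitz bounds then make the convergence locally uniform. -/
theorem exists_tendsto_of_abs_sub_le {F : ℕ → ℝ → ℝ} {K : ℝ}
    (hF : ∀ n x y, |F n x - F n y| ≤ K * |x - y|) (h0 : ∀ n, F n 0 = 0) :
    ∃ (u : ℝ → ℝ) (f : Filter ℕ), (∀ x y, |u x - u y| ≤ K * |x - y|) ∧ f.NeBot ∧ f ≤ atTop ∧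
      ∀ x, Tendsto (fun n => F n x) f (𝓝 (u x)) := by
  set f : Ultrafilter ℕ := hyperfilter ℕ with hf
  have hex : ∀ x, ∃ y, Tendsto (fun n => F n x) f (𝓝 y) := fun x => by
    obtain ⟨y, -, hy⟩ := (isCompact_Icc (a := -(K * |x|)) (b := K * |x|)).ultrafilter_le_nhds
      (f.map fun n => F n x) (by
        rw [le_principal_iff, Ultrafilter.coe_map, Filter.mem_map]
        refine Filter.univ_mem' fun n => abs_le.1 ?_
        simpa [h0] using hF n x 0)
    exact ⟨y, hy⟩
  choose u hu using hex
  refine ⟨u, f, fun x y => ?_, inferInstance, Nat.hyperfilter_le_atTop, hu⟩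
  exact le_of_tendsto ((hu x).sub (hu y)).abs (Eventually.of_forall fun (n : ℕ) => hF n x y)

theorem SupersolutionOn.of_tendsto {ι : Type*} {a : ℝ → ℝ} {G : ℝ → ℝ → ℝ} {l K : ℝ}
    {f : Filter ι} [f.NeBot] {F : ι → ℝ → ℝ} {u : ℝ → ℝ}
    (ha : Continuous a) (hG : Continuous (Function.uncurry G))
    (hK : 0 < K) (hF : ∀ n x y, |F n x - F n y| ≤ K * |x - y|)
    (hu : ∀ x y, |u x - u y| ≤ K * |x - y|) (ht : ∀ x, Tendsto (fun n => F n x) f (𝓝 (u x)))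
    (h : ∀ R δ : ℝ, 0 < δ → ∀ᶠ n in f, SupersolutionOn a G (l + δ) (F n) (Ioo (-R) R)) :
    SupersolutionOn a G l u univ := by
  intro z _ p b hj
  refine le_of_isLowerJet_of_approx ha hG one_pos (fun δ hδ => ?_) hj
  obtain ⟨n, hn, hn'⟩ := ((h (|z| + 1) δ hδ).and (eventually_forall_abs_sub_le hK hF hu ht
    (isCompact_Icc (a := z - 1) (b := z + 1)) hδ)).exists
  refine ⟨F n, continuous_of_abs_sub_le hK.le (hF n),
    hn.mono_set (Ioo_subset_Ioo (by linarith [neg_abs_le z]) (by linarith [le_abs_self z])),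
    fun x hx => ?_, ?_⟩
  · linarith [(abs_le.1 (hn' x (Ioo_subset_Icc_self hx))).1]
  · linarith [(abs_le.1 (hn' z ⟨by linarith, by linarith⟩)).2]

/-! ### Perron's method. -/

theorem IsLowerJet.of_parabola {k p b x₀ z q d : ℝ}
    (h : IsLowerJet (fun x => k + (p * (x - x₀) + b / 2 * (x - x₀) ^ 2)) z q d) :
    q = p + b * (z - x₀) ∧ d ≤ b := by
  have hd := (((hasDerivAt_parabola p b x₀ z).const_add k).sub (hasDerivAt_parabola q d z z))
  have hq := IsLocalMin.hasDerivAt_eq_zero h hd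
  have hq' : q = p + b * (z - x₀) := by rw [sub_self, mul_zero] at hq; linarith
  refine ⟨hq', ?_⟩
  obtain ⟨x, hx, hx'⟩ :=
    ((Eventually.filter_mono (nhdsWithin_le_nhds (s := Ioi z)) h).and self_mem_nhdsWithin).exists
  have hp : 0 < (x - z) ^ 2 := pow_pos (sub_pos.2 hx') 2
  simp only at hx
  have : 0 ≤ (b - d) * (x - z) ^ 2 := by rw [hq'] at hx; nlinarith
  linarith [nonneg_of_mul_nonneg_left this hp]

/-- The pointwise infimum of a family of functions. -/
noncomputable def infFun (S : Set (ℝ → ℝ)) (x : ℝ) : ℝ := ⨅ w : S, w.1 x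

theorem bddBelow_range_of_lipschitz {S : Set (ℝ → ℝ)} {K y : ℝ}
    (hS : ∀ w ∈ S, ∀ x x', |w x - w x'| ≤ K * |x - x'|) (hy : ∀ w ∈ S, w y = 0) (x : ℝ) :
    BddBelow (range fun w : S => w.1 x) :=
  ⟨-(K * |x - y|), by
    rintro _ ⟨w, rfl⟩
    have := hS w.1 w.2 x y
    rw [hy w.1 w.2, sub_zero] at this
    exact (abs_le.1 this).1⟩

theorem infFun_lipschitz {S : Set (ℝ → ℝ)} {K y : ℝ} (hne : S.Nonempty)
    (hS : ∀ w ∈ S, ∀ x x', |w x - w x'| ≤ K * |x - x'|) (hy : ∀ w ∈ S, w y = 0) (x x' : ℝ) :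
    |infFun S x - infFun S x'| ≤ K * |x - x'| := by
  have : Nonempty S := hne.to_subtype
  have key : ∀ x x', infFun S x - K * |x - x'| ≤ infFun S x' := fun x x' =>
    le_ciInf fun w => by
      have h1 : infFun S x ≤ w.1 x := ciInf_le (bddBelow_range_of_lipschitz hS hy x) w
      linarith [(abs_le.1 (hS w.1 w.2 x x')).2]
  have h1 := key x x'
  have h2 := key x' x
  rw [abs_sub_comm x' x] at h2
  exact abs_le.2 ⟨by linarith, by linarith⟩

theorem infFun_supersolutionOn {a : ℝ → ℝ} {G : ℝ → ℝ → ℝ} {l K y : ℝ} {S : Set (ℝ → ℝ)}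
    (ha : Continuous a) (hG : Continuous (Function.uncurry G)) (hK : 0 ≤ K) (hne : S.Nonempty)
    (hS : ∀ w ∈ S, ∀ x x', |w x - w x'| ≤ K * |x - x'|) (hy : ∀ w ∈ S, w y = 0)
    (hsup : ∀ w ∈ S, SupersolutionOn a G l w univ) :
    SupersolutionOn a G l (infFun S) univ := by
  intro z _ p b hj
  have : Nonempty S := hne.to_subtype
  refine le_of_isLowerJet_of_approx ha hG one_pos (fun δ hδ => ?_) hj
  obtain ⟨w, hw⟩ := exists_lt_of_ciInf_lt (show infFun S z < infFun S z + δ by linarith)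
  refine ⟨w.1, continuous_of_abs_sub_le hK (hS w.1 w.2),
    ((hsup w.1 w.2).mono_level (by linarith)).mono_set (subset_univ _), fun x _ => ?_, hw.le⟩
  have h1 : infFun S x ≤ w.1 x := ciInf_le (bddBelow_range_of_lipschitz hS hy x) w
  linarith

/-- Lowering a supersolution `m` near a point where it fails to be a subsolution. -/
theorem exists_bump {a : ℝ → ℝ} {G : ℝ → ℝ → ℝ} {l x₀ y p b : ℝ} {m : ℝ → ℝ}
    (ha : Continuous a) (ha0 : ∀ x, 0 ≤ a x) (hG : Continuous (Function.uncurry G)) (hm : Continuous m)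
    (hsup : SupersolutionOn a G l m univ) (hy : x₀ ≠ y) (hj : IsLowerJet (fun x => -m x) x₀ p b)
    (hlt : a x₀ * -b + G x₀ (-p) < l) :
    ∃ w, Continuous w ∧ SupersolutionOn a G l w univ ∧ w y = m y ∧ w x₀ < m x₀ := by
  obtain ⟨ε, hε, hεlt⟩ : ∃ ε > 0, a x₀ * (-b + ε) + G x₀ (-p) < l := by
    have hc : Tendsto (fun ε => a x₀ * (-b + ε) + G x₀ (-p)) (𝓝[>] 0)
        (𝓝 (a x₀ * (-b + 0) + G x₀ (-p))) := Continuous.continuousWithinAt (by fun_prop)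
    rw [add_zero] at hc
    obtain ⟨ε, h1, h2⟩ := ((hc.eventually (gt_mem_nhds hlt)).and self_mem_nhdsWithin).exists
    exact ⟨ε, h2, h1⟩
  set B := -b + ε with hB
  have hFc : Continuous fun x => a x * B + G x (-p + B * (x - x₀)) := by
    have : Continuous fun t => Function.uncurry G (t, -p + B * (t - x₀)) := hG.comp (by fun_prop)
    exact (ha.mul continuous_const).add this
  have h1 : ∀ᶠ x in 𝓝 x₀, a x * B + G x (-p + B * (x - x₀)) < l :=
    hFc.continuousAt.eventually (gt_mem_nhds (by simpa using hεlt))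
  obtain ⟨ρ, hρ, hball⟩ :=
    Metric.eventually_nhds_iff.1 ((h1.and hj).and (isOpen_ne.mem_nhds hy))
  simp only [Real.dist_eq] at hball
  -- The extra curvature `ε` gains exactly `η` at distance `ρ / 2`, so the lowered parabola is above
  -- `m` from there on and `min m φ` glues with `m`.
  set η := ε / 2 * (ρ / 2) ^ 2 with hη
  have hηp : 0 < η := by positivity
  set φ : ℝ → ℝ := fun x => m x₀ - η + (-p * (x - x₀) + B / 2 * (x - x₀) ^ 2) with hφ
  have hmφ : ∀ x, |x - x₀| < ρ → ρ / 2 ≤ |x - x₀| → m x ≤ φ x := fun x hx hx' => by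
    have h2 := (hball hx).1.2
    simp only [sub_self] at h2
    have h3 : (ρ / 2) ^ 2 ≤ (x - x₀) ^ 2 := by rw [← sq_abs (x - x₀)]; gcongr
    simp only [hφ, hη, hB]
    nlinarith
  set w : ℝ → ℝ := fun x => if |x - x₀| < ρ then min (m x) (φ x) else m x with hw
  have hwle : ∀ x, w x ≤ m x := fun x => by
    simp only [hw]; split_ifs
    · exact min_le_left _ _
    · exact le_rfl
  have hwout : ∀ x, ρ / 2 ≤ |x - x₀| → w x = m x := fun x hx => by
    simp only [hw]; split_ifs with h
    · exact min_eq_left (hmφ x h hx)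
    · rfl
  have hwin : ∀ x, |x - x₀| < ρ → w x = min (m x) (φ x) := fun x hx => if_pos hx
  have hφc : Continuous φ := by rw [hφ]; fun_prop
  have habs : Continuous fun x => |x - x₀| := by fun_prop
  refine ⟨w, continuous_iff_continuousAt.2 fun z => ?_, fun z _ q d hzj => ?_, ?_, ?_⟩
  · rcases lt_or_ge (|z - x₀|) ρ with h | h
    · refine (hm.min hφc).continuousAt.congr ?_
      filter_upwards [habs.continuousAt.eventually (gt_mem_nhds h)] with x hx using (hwin x hx).symm
    · refine hm.continuousAt.congr ?_
      filter_upwards [habs.continuousAt.eventually (lt_mem_nhds (show ρ / 2 < |z - x₀| by linarith))]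
        with x hx using (hwout x (le_of_lt hx)).symm
  · by_cases hz : w z = m z
    · refine hsup z (mem_univ z) q d ?_
      unfold IsLowerJet at *
      filter_upwards [hzj] with x hx
      rw [hz] at hx
      exact hx.trans (sub_le_sub_right (hwle x) _)
    · have hzρ : |z - x₀| < ρ := by
        by_contra hcon
        exact hz (if_neg hcon)
      have hzφ : w z = φ z := by
        rw [hwin z hzρ] at hz ⊢
        exact (min_choice _ _).resolve_left hz
      have hjφ : IsLowerJet φ z q d := by
        unfold IsLowerJet at *
        filter_upwards [hzj, habs.continuousAt.eventually (gt_mem_nhds hzρ)] with x hx hx'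
        rw [hzφ, hwin x hx'] at hx
        exact hx.trans (sub_le_sub_right (min_le_right _ _) _)
      obtain ⟨rfl, hd⟩ := hjφ.of_parabola
      linarith [(hball hzρ).1.1, mul_le_mul_of_nonneg_left hd (ha0 z)]
  · refine hwout y ?_
    by_contra hcon
    exact (hball (show |y - x₀| < ρ by linarith)).2 rfl
  · rw [hwin x₀ (by simpa using hρ)]
    refine (min_le_right _ _).trans_lt ?_
    simp only [hφ, sub_self]
    linarith

/-- Competitors are normalised to vanish at `y`; with the Lipschitz bound this makes their infimum
finite. A bump away from `y` keeps the normalisation and would contradict minimality. -/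
theorem exists_perron {a : ℝ → ℝ} {G : ℝ → ℝ → ℝ} {κ l M c D : ℝ} {w₀ : ℝ → ℝ}
    (hG : CoerciveAbove G l M c D) (ha : DegenerateCoeff κ a)
    (hGc : Continuous (Function.uncurry G)) (hw₀ : SupersolutionOn a G l w₀ univ)
    (hw₀c : Continuous w₀) (y : ℝ) :
    ∃ m, Continuous m ∧ SupersolutionOn a G l m univ ∧
      SupersolutionOn a (fun x p => -G x (-p)) (-l) (fun x => -m x) {y}ᶜ := by
  set S : Set (ℝ → ℝ) := {w | Continuous w ∧ SupersolutionOn a G l w univ ∧ w y = 0} with hS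
  have hne : S.Nonempty := ⟨fun x => w₀ x + -w₀ y, hw₀c.add continuous_const,
    hw₀.add_const _, by simp⟩
  have hlip : ∀ w ∈ S, ∀ x x', |w x - w x'| ≤ M * |x - x'| := fun w hw x x' =>
    SupersolutionOn.lipschitz hG ha hw.2.1 hw.1 x x'
  have hy : ∀ w ∈ S, w y = 0 := fun w hw => hw.2.2
  have hc : Continuous (infFun S) :=
    continuous_of_abs_sub_le hG.pos.le (infFun_lipschitz hne hlip hy)
  have hsup := infFun_supersolutionOn ha.continuous hGc hG.pos.le hne hlip hy
    (fun w hw => hw.2.1)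
  refine ⟨infFun S, hc, hsup, fun z hz p b hj => ?_⟩
  by_contra! hlt
  obtain ⟨w, hwc, hw, hwy, hwz⟩ := exists_bump ha.continuous ha.nonneg hGc hc hsup hz hj (by linarith)
  have hmy : infFun S y = 0 := by
    have : Nonempty S := hne.to_subtype
    unfold infFun
    rw [iInf_congr (g := fun _ => (0 : ℝ)) fun w : S => hy w.1 w.2, ciInf_const]
  have : infFun S z ≤ w z :=
    ciInf_le (bddBelow_range_of_lipschitz hlip hy z) ⟨w, hwc, hw, hwy.trans hmy⟩
  linarith

/-! ### Existence of supersolutions and solutions on the line. -/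

theorem CoerciveAbove.mono_level {G : ℝ → ℝ → ℝ} {l l' M c D : ℝ} (h : CoerciveAbove G l M c D)
    (hl : l' ≤ l) : CoerciveAbove G l' M c D :=
  ⟨h.pos, h.cpos, h.lower, fun x p hp => by linarith [h.growth x p hp]⟩

/-- Existence of a global Lipschitz supersolution at the level `l` from supersolutions at nearby
higher levels. -/
theorem exists_supersolution_of_forall_lt {a : ℝ → ℝ} {G : ℝ → ℝ → ℝ} {κ l l' M c D : ℝ}
    (hl : l < l') (hG : CoerciveAbove G l' M c D) (ha : DegenerateCoeff κ a)
    (hGc : Continuous (Function.uncurry G))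
    (hex : ∀ δ > 0, ∃ w, Continuous w ∧ SupersolutionOn a G (l + δ) w univ) :
    ∃ w, Continuous w ∧ SupersolutionOn a G l w univ := by
  -- The levels `l + δ n` stay at most `l'`, so the same Lipschitz constant `M` serves them all.
  set δ : ℕ → ℝ := fun n => (l' - l) * (1 / ((n : ℝ) + 1)) with hδ
  have hl' : 0 < l' - l := sub_pos.2 hl
  have hδp : ∀ n, 0 < δ n := fun n => by simp only [hδ]; positivity
  have hδl : ∀ n, l + δ n ≤ l' := fun n => by
    have : 1 / ((n : ℝ) + 1) ≤ 1 := by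
      rw [div_le_one (by positivity)]; linarith [Nat.cast_nonneg (α := ℝ) n]
    simp only [hδ]
    nlinarith
  choose w hwc hw using fun n => hex (δ n) (hδp n)
  have hlip : ∀ n x y, |w n x + -w n 0 - (w n y + -w n 0)| ≤ M * |x - y| := fun n x y => by
    rw [add_sub_add_right_eq_sub]
    exact (hw n).lipschitz (hG.mono_level (hδl n)) ha (hwc n) x y
  obtain ⟨u, f, hu, hf, hfa, ht⟩ :=
    exists_tendsto_of_abs_sub_le (F := fun n x => w n x + -w n 0) hlip (by simp)
  refine ⟨u, continuous_of_abs_sub_le hG.pos.le hu,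
    SupersolutionOn.of_tendsto ha.continuous hGc hG.pos hlip hu ht fun R ε hε => ?_⟩
  have hδt : Tendsto δ atTop (𝓝 0) := by
    simpa [hδ] using tendsto_one_div_add_atTop_nhds_zero_nat.const_mul (l' - l)
  filter_upwards [hfa (hδt.eventually (gt_mem_nhds hε))] with n hn
  exact (((hw n).mono_level (by linarith)).add_const _).mono_set (subset_univ _)

/-- The point `n` where the subsolution property may fail leaves every bounded interval, so it
disappears in the limit. -/
theorem exists_solution {a : ℝ → ℝ} {G : ℝ → ℝ → ℝ} {κ l M c D : ℝ} {w₀ : ℝ → ℝ}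
    (hG : CoerciveAbove G l M c D) (ha : DegenerateCoeff κ a)
    (hGc : Continuous (Function.uncurry G)) (hw₀ : SupersolutionOn a G l w₀ univ)
    (hw₀c : Continuous w₀) :
    ∃ u, (∀ x y, |u x - u y| ≤ M * |x - y|) ∧ SupersolutionOn a G l u univ ∧
      SupersolutionOn a (fun x p => -G x (-p)) (-l) (fun x => -u x) univ := by
  choose m hmc hm hm' using fun n : ℕ => exists_perron hG ha hGc hw₀ hw₀c (n : ℝ)
  have hlip : ∀ n x y, |m n x + -m n 0 - (m n y + -m n 0)| ≤ M * |x - y| := fun n x y => by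
    rw [add_sub_add_right_eq_sub]
    exact (hm n).lipschitz hG ha (hmc n) x y
  obtain ⟨u, f, hu, hf, hfa, ht⟩ :=
    exists_tendsto_of_abs_sub_le (F := fun n x => m n x + -m n 0) hlip (by simp)
  have hneg : ∀ {v : ℝ → ℝ}, (∀ x y, |v x - v y| ≤ M * |x - y|) →
      ∀ x y, |-v x - -v y| ≤ M * |x - y| := fun {v} hv x y => by
    rw [neg_sub_neg, abs_sub_comm]; exact hv x y
  refine ⟨u, hu, SupersolutionOn.of_tendsto ha.continuous hGc hG.pos hlip hu ht fun R ε hε => ?_,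
    SupersolutionOn.of_tendsto (f := f) (F := fun n x => -(m n x + -m n 0)) ha.continuous ?_
      hG.pos (fun n => hneg (hlip n)) (hneg hu) (fun x => (ht x).neg) fun R ε hε => ?_⟩
  · exact Eventually.of_forall fun n =>
      (((hm n).mono_level (by linarith)).add_const _).mono_set (subset_univ _)
  · exact (hGc.comp (continuous_fst.prodMk continuous_snd.neg)).neg
  · filter_upwards [hfa (eventually_ge_atTop ⌈R⌉₊)] with n hn
    have h1 := (((hm' n).mono_level (show -l ≤ -l + ε by linarith)).add_const (m n 0)).mono_set
      (show Ioo (-R) R ⊆ {(n : ℝ)}ᶜ from fun x hx h => by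
        have h2 : R ≤ n := (Nat.le_ceil R).trans (by exact_mod_cast hn)
        rw [mem_singleton_iff] at h
        linarith [hx.2])
    convert h1 using 2
    ring

/-! ### Regularity where the diffusion is positive. -/

theorem IsLowerJet.slope_le_of_lipschitz {w : ℝ → ℝ} {K z q b : ℝ}
    (hw : ∀ x y, |w x - w y| ≤ K * |x - y|) (hj : IsLowerJet w z q b) : q ≤ K := by
  have hc : Tendsto (fun x => q + b / 2 * (x - z)) (𝓝[>] z) (𝓝 (q + b / 2 * (z - z))) :=
    Continuous.continuousWithinAt (by fun_prop)
  rw [sub_self, mul_zero, add_zero] at hc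
  refine le_of_tendsto hc ?_
  filter_upwards [Eventually.filter_mono (nhdsWithin_le_nhds (s := Ioi z)) hj,
    self_mem_nhdsWithin] with x hx hx'
  have hp : 0 < x - z := sub_pos.2 hx'
  have h1 := (abs_le.1 (hw x z)).2
  rw [abs_of_pos hp] at h1
  simp only [sub_self] at hx
  refine le_of_mul_le_mul_right ?_ hp
  nlinarith

theorem IsLowerJet.abs_slope_le_of_lipschitz {w : ℝ → ℝ} {K z q b : ℝ}
    (hw : ∀ x y, |w x - w y| ≤ K * |x - y|) (hj : IsLowerJet w z q b) : |q| ≤ K := by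
  have hj' : IsLowerJet (fun x => w (-x)) (-z) (-q) b :=
    IsLowerJet.reflect (w := fun x => w (-x)) (by simpa only [neg_neg] using hj)
  have := hj'.slope_le_of_lipschitz (K := K) fun x y => by
    refine (hw _ _).trans_eq ?_
    rw [neg_sub_neg, abs_sub_comm]
  exact abs_le.2 ⟨by linarith, hj.slope_le_of_lipschitz hw⟩

/-- The two convex functions add up to `N x²`, which has no corner; a corner of either would be
convex and could not cancel. -/
theorem differentiableAt_of_convexOn_parabola {u : ℝ → ℝ} {N x : ℝ} {s : Set ℝ}
    (h₁ : ConvexOn ℝ s (fun x => N / 2 * x ^ 2 - u x))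
    (h₂ : ConvexOn ℝ s (fun x => N / 2 * x ^ 2 - -u x)) (hx : x ∈ interior s) :
    DifferentiableAt ℝ u x := by
  have hsum : HasDerivAt (fun x : ℝ => (N / 2 * x ^ 2 - u x) + (N / 2 * x ^ 2 - -u x))
      (2 * N * x) x := by
    have : HasDerivAt (fun x : ℝ => N * x ^ 2) (N * (2 * x)) x := by
      simpa using ((hasDerivAt_id x).pow 2).const_mul N
    refine (this.congr_deriv (by ring)).congr_of_eventuallyEq (Eventually.of_forall fun y => ?_)
    simp only
    ring
  have hr₁ := h₁.hasDerivWithinAt_rightDeriv_of_mem_interior hx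
  have hl₁ := h₁.hasDerivWithinAt_leftDeriv_of_mem_interior hx
  have hle₁ := h₁.leftDeriv_le_rightDeriv_of_mem_interior hx
  have hr₂ := h₂.hasDerivWithinAt_rightDeriv_of_mem_interior hx
  have hl₂ := h₂.hasDerivWithinAt_leftDeriv_of_mem_interior hx
  have hle₂ := h₂.leftDeriv_le_rightDeriv_of_mem_interior hx
  have e₁ := (uniqueDiffWithinAt_Ioi x).eq_deriv _ (hr₁.fun_add hr₂) hsum.hasDerivWithinAt
  have e₂ := (uniqueDiffWithinAt_Iio x).eq_deriv _ (hl₁.fun_add hl₂) hsum.hasDerivWithinAt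
  have heq : derivWithin (fun x => N / 2 * x ^ 2 - u x) (Iio x) x =
      derivWithin (fun x => N / 2 * x ^ 2 - u x) (Ioi x) x := by linarith
  rw [heq] at hl₁
  have hd : DifferentiableAt ℝ (fun x => N / 2 * x ^ 2 - u x) x :=
    (hasDerivAt_iff_tendsto_slope_left_right.2
      ⟨(hasDerivWithinAt_iff_tendsto_slope' (by simp)).1 hl₁,
        (hasDerivWithinAt_iff_tendsto_slope' (by simp)).1 hr₁⟩).differentiableAt
  have hq : DifferentiableAt ℝ (fun x : ℝ => N / 2 * x ^ 2) x := by fun_prop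
  simpa using hq.fun_sub hd

theorem continuousAt_deriv_of_convexOn_parabola {u : ℝ → ℝ} {N x : ℝ} {s : Set ℝ}
    (hs : IsOpen s)
    (h₁ : ConvexOn ℝ s (fun x => N / 2 * x ^ 2 - u x))
    (h₂ : ConvexOn ℝ s (fun x => N / 2 * x ^ 2 - -u x)) (hx : x ∈ s) :
    ContinuousAt (deriv u) x := by
  have hd : ∀ y ∈ s, HasDerivAt u (deriv u y) y := fun y hy =>
    (differentiableAt_of_convexOn_parabola h₁ h₂ (by rwa [hs.interior_eq])).hasDerivAt
  have hq : ∀ y : ℝ, HasDerivAt (fun x : ℝ => N / 2 * x ^ 2) (N * y) y := fun y => by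
    refine (((hasDerivAt_id y).pow 2).const_mul (N / 2)).congr_deriv ?_
    simp
    ring
  have d₁ : ∀ y ∈ s, HasDerivAt (fun x => N / 2 * x ^ 2 - u x) (N * y - deriv u y) y :=
    fun y hy => (hq y).sub (hd y hy)
  have d₂ : ∀ y ∈ s, HasDerivAt (fun x => N / 2 * x ^ 2 - -u x) (N * y - -deriv u y) y :=
    fun y hy => (hq y).sub (hd y hy).neg
  have m₁ := h₁.monotoneOn_deriv fun y hy => (d₁ y hy).differentiableAt
  have m₂ := h₂.monotoneOn_deriv fun y hy => (d₂ y hy).differentiableAt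
  have key : ∀ y ∈ s, ∀ z ∈ s, y ≤ z → |deriv u y - deriv u z| ≤ N * (z - y) := by
    intro y hy z hz hyz
    have e₁ := m₁ hy hz hyz
    have e₂ := m₂ hy hz hyz
    rw [(d₁ y hy).deriv, (d₁ z hz).deriv] at e₁
    rw [(d₂ y hy).deriv, (d₂ z hz).deriv] at e₂
    exact abs_le.2 ⟨by linarith, by linarith⟩
  have key' : ∀ y ∈ s, |deriv u y - deriv u x| ≤ N * |y - x| := fun y hy => by
    rcases le_total y x with h | h
    · rw [abs_sub_comm y x, abs_of_nonneg (sub_nonneg.2 h)]; exact key y hy x hx h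
    · rw [abs_of_nonneg (sub_nonneg.2 h), abs_sub_comm]; exact key x hx y hy h
  have ht : Tendsto (fun y => N * |y - x|) (𝓝 x) (𝓝 0) := by
    have : ContinuousAt (fun y => N * |y - x|) x := by fun_prop
    simpa [ContinuousAt] using this
  rw [ContinuousAt, tendsto_iff_dist_tendsto_zero]
  refine squeeze_zero' (Eventually.of_forall fun y => dist_nonneg) ?_ ht
  filter_upwards [hs.mem_nhds hx] with y hy
  rw [Real.dist_eq]
  exact key' y hy

theorem exists_abs_le_of_continuous {G : ℝ → ℝ → ℝ} (hG : Continuous (Function.uncurry G))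
    (R K : ℝ) : ∃ B, ∀ x p, |x| ≤ R → |p| ≤ K → |G x p| ≤ B := by
  obtain ⟨B, hB⟩ := ((isCompact_Icc (a := -R) (b := R)).prod
    (isCompact_Icc (a := -K) (b := K))).exists_bound_of_continuousOn hG.continuousOn
  exact ⟨B, fun x p hx hp => hB (x, p) ⟨abs_le.1 hx, abs_le.1 hp⟩⟩

/-- Slopes of jets are at most `K`, so `G` is bounded at them and the equation bounds second
derivatives. All large `N` are allowed so that `u` and `-u` can share one. -/
theorem SupersolutionOn.exists_convexOn {a : ℝ → ℝ} {G : ℝ → ℝ → ℝ} {l K : ℝ} {w : ℝ → ℝ}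
    (ha : Continuous a) (hpos : ∀ x, 0 < a x) (hG : Continuous (Function.uncurry G))
    (hlip : ∀ x y, |w x - w y| ≤ K * |x - y|) (hwc : Continuous w)
    (hw : SupersolutionOn a G l w univ) (R : ℝ) (hR : 0 < R) :
    ∃ N₀, ∀ N ≥ N₀, ConvexOn ℝ (Ioo (-R) R) (fun x => N / 2 * x ^ 2 - w x) := by
  obtain ⟨B, hB⟩ := exists_abs_le_of_continuous hG R K
  obtain ⟨y, hy, hymin⟩ := (isCompact_Icc (a := -R) (b := R)).exists_isMinOn
    (nonempty_Icc.2 (by linarith)) ha.continuousOn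
  refine ⟨(|l| + |B|) / a y, fun N hN =>
    convexOn_parabola_sub_of_forall_isLowerJet (convex_Ioo _ _) hwc.continuousOn
      fun z hz p b hj => le_trans ?_ hN⟩
  rw [interior_Ioo] at hz
  have hay : a y ≤ a z := hymin (Ioo_subset_Icc_self hz)
  have h1 := hw z (mem_univ z) p b hj
  have h2 := (abs_le.1 (hB z p (abs_le.2 ⟨hz.1.le, hz.2.le⟩)
    (hj.abs_slope_le_of_lipschitz hlip))).1
  have h3 := le_abs_self l
  have h4 := le_abs_self B
  rw [le_div_iff₀ (hpos y)]
  rcases le_or_gt b 0 with hb | hb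
  · nlinarith [abs_nonneg l, abs_nonneg B, hpos y]
  · nlinarith

/-- Lipschitz viscosity solutions of a nondegenerate equation are `C²`. -/
theorem contDiff_two_of_solution {a : ℝ → ℝ} {G : ℝ → ℝ → ℝ} {l K : ℝ} {u : ℝ → ℝ}
    (ha : Continuous a) (hpos : ∀ x, 0 < a x) (hG : Continuous (Function.uncurry G))
    (hlip : ∀ x y, |u x - u y| ≤ K * |x - y|) (huc : Continuous u)
    (hsup : SupersolutionOn a G l u univ)
    (hsub : SupersolutionOn a (fun x p => -G x (-p)) (-l) (fun x => -u x) univ) :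
    ContDiff ℝ 2 u := by
  have hG' : Continuous (Function.uncurry fun x p => -G x (-p)) :=
    (hG.comp (continuous_fst.prodMk continuous_snd.neg)).neg
  have hC : ∀ x, DifferentiableAt ℝ u x ∧ ContinuousAt (deriv u) x := fun x => by
    have hR : 0 < |x| + 1 := by positivity
    have hx : x ∈ Ioo (-(|x| + 1)) (|x| + 1) :=
      ⟨by linarith [neg_abs_le x], by linarith [le_abs_self x]⟩
    obtain ⟨N₁, h₁⟩ := hsup.exists_convexOn ha hpos hG hlip huc _ hR
    obtain ⟨N₂, h₂⟩ := hsub.exists_convexOn (w := fun x => -u x) (K := K) ha hpos hG'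
      (fun x y => by rw [neg_sub_neg, abs_sub_comm]; exact hlip x y) huc.neg _ hR
    have c₁ := h₁ _ (le_max_left N₁ N₂)
    have c₂ := h₂ _ (le_max_right N₁ N₂)
    exact ⟨differentiableAt_of_convexOn_parabola c₁ c₂ (by rwa [interior_Ioo]),
      continuousAt_deriv_of_convexOn_parabola isOpen_Ioo c₁ c₂ hx⟩
  have hud : ∀ x, HasDerivAt u (deriv u x) x := fun x => (hC x).1.hasDerivAt
  have hdc : Continuous (deriv u) := continuous_iff_continuousAt.2 fun x => (hC x).2
  set f : ℝ → ℝ := fun x => (l - G x (deriv u x)) / a x with hf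
  have hfc : Continuous f := by
    have : Continuous fun x => Function.uncurry G (x, deriv u x) := hG.comp (by fun_prop)
    exact (continuous_const.sub this).div ha fun x => (hpos x).ne'
  have haf : ∀ x, a x * f x = l - G x (deriv u x) := fun x => mul_div_cancel₀ _ (hpos x).ne'
  set v : ℝ → ℝ := fun x => ∫ t in (0 : ℝ)..x, f t with hv
  have hvd : ∀ x, HasDerivAt v (f x) x := fun x =>
    intervalIntegral.integral_hasDerivAt_right (hfc.intervalIntegrable _ _)
      (hfc.stronglyMeasurableAtFilter _ _) hfc.continuousAt
  have hvc : Continuous v := continuous_iff_continuousAt.2 fun x => (hvd x).continuousAt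
  set F : ℝ → ℝ := fun x => ∫ t in (0 : ℝ)..x, v t with hF
  have hFd : ∀ x, HasDerivAt F (v x) x := fun x =>
    intervalIntegral.integral_hasDerivAt_right (hvc.intervalIntegrable _ _)
      (hvc.stronglyMeasurableAtFilter _ _) hvc.continuousAt
  have hFc : Continuous F := continuous_iff_continuousAt.2 fun x => (hFd x).continuousAt
  -- Here `F'' = f` is the second derivative the equation prescribes. A concave parabola with `c <
  -- 0` above `u - F` would give `l ≤ l + a z * c`. With `conv₂`, `u - F` is affine.
  have conv₁ : ConvexOn ℝ univ (fun x => u x - F x) := by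
    refine convexOn_of_forall_not_isLocalMax convex_univ (huc.sub hFc).continuousOn
      fun z _ p c hc hmax => ?_
    have hφ : ∀ x, HasDerivAt (fun x => -(F x + (p * (x - z) + c / 2 * (x - z) ^ 2)))
        (-(v x + (p + c * (x - z)))) x := fun x => ((hFd x).add (hasDerivAt_parabola p c z x)).neg
    have hφ' : HasDerivAt (fun x => -(v x + (p + c * (x - z)))) (-(f z + c)) z :=
      ((hvd z).add (hasDerivAt_parabola_slope p c z z)).neg
    have hmin : IsLocalMin
        (fun x => -u x - -(F x + (p * (x - z) + c / 2 * (x - z) ^ 2))) z := by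
      filter_upwards [hmax] with x hx
      linarith
    have hslope := hmin.hasDerivAt_eq_zero ((hud z).neg.sub (hφ z))
    have := hsub.le_of_isLocalMin (mem_univ z) (Eventually.of_forall hφ) hφ' hmin
    rw [show - -(v z + (p + c * (z - z))) = deriv u z by linarith] at this
    nlinarith [haf z, mul_neg_of_pos_of_neg (hpos z) hc]
  have conv₂ : ConvexOn ℝ univ (fun x => F x - u x) := by
    refine convexOn_of_forall_not_isLocalMax convex_univ (hFc.sub huc).continuousOn
      fun z _ p c hc hmax => ?_
    have hφ : ∀ x, HasDerivAt (fun x => F x - (p * (x - z) + c / 2 * (x - z) ^ 2))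
        (v x - (p + c * (x - z))) x := fun x => (hFd x).sub (hasDerivAt_parabola p c z x)
    have hφ' : HasDerivAt (fun x => v x - (p + c * (x - z))) (f z - c) z :=
      (hvd z).sub (hasDerivAt_parabola_slope p c z z)
    have hmin : IsLocalMin (fun x => u x - (F x - (p * (x - z) + c / 2 * (x - z) ^ 2))) z := by
      filter_upwards [hmax] with x hx
      linarith
    have hslope := hmin.hasDerivAt_eq_zero ((hud z).sub (hφ z))
    have := hsup.le_of_isLocalMin (mem_univ z) (Eventually.of_forall hφ) hφ' hmin
    rw [show v z - (p + c * (z - z)) = deriv u z by linarith] at this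
    nlinarith [haf z, mul_neg_of_pos_of_neg (hpos z) hc]
  have d₁ : ∀ x, HasDerivAt (fun x => u x - F x) (deriv u x - v x) x := fun x =>
    (hud x).sub (hFd x)
  have d₂ : ∀ x, HasDerivAt (fun x => F x - u x) (v x - deriv u x) x := fun x =>
    (hFd x).sub (hud x)
  have m₁ := conv₁.monotoneOn_deriv fun x _ => (d₁ x).differentiableAt
  have m₂ := conv₂.monotoneOn_deriv fun x _ => (d₂ x).differentiableAt
  have key : ∀ x y, x ≤ y → deriv u x - v x = deriv u y - v y := fun x y hxy => by
    have e₁ := m₁ (mem_univ x) (mem_univ y) hxy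
    have e₂ := m₂ (mem_univ x) (mem_univ y) hxy
    rw [(d₁ x).deriv, (d₁ y).deriv] at e₁
    rw [(d₂ x).deriv, (d₂ y).deriv] at e₂
    linarith
  have hdu : deriv u = fun x => v x + (deriv u 0 - v 0) := funext fun x => by
    rcases le_total x 0 with h | h
    · linarith [key x 0 h]
    · linarith [key 0 x h]
  have hvC : ContDiff ℝ 1 v := contDiff_one_iff_deriv.2
    ⟨fun x => (hvd x).differentiableAt, by
      rw [show deriv v = f from funext fun x => (hvd x).deriv]; exact hfc⟩
  rw [show (2 : WithTop ℕ∞) = 1 + 1 from one_add_one_eq_two.symm, contDiff_succ_iff_deriv]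
  refine ⟨fun x => (hC x).1, by simp, ?_⟩
  rw [hdu]
  exact hvC.add contDiff_const

/-! ### The lower bound on levels and the explicit constant. -/

/-- A level at which there is a supersolution is at least every lower bound of `G`. -/
theorem SupersolutionOn.le_level {a : ℝ → ℝ} {G : ℝ → ℝ → ℝ} {l K I : ℝ} {w : ℝ → ℝ}
    (ha1 : ∀ x, a x ≤ 1) (hI : ∀ x p, I ≤ G x p)
    (hK : 0 < K) (hlip : ∀ x y, |w x - w y| ≤ K * |x - y|) (hw : SupersolutionOn a G l w univ) :
    I ≤ l := by
  have hwc := continuous_of_abs_sub_le hK.le hlip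
  refine le_of_forall_pos_le_add fun ε hε => ?_
  set J : ℝ → ℝ := fun x => 0 * (x - 0) + -ε / 2 * (x - 0) ^ 2 with hJ
  -- Beyond this radius the parabola outweighs the Lipschitz growth of `w`, so the minimum is
  -- interior.
  set R := 2 * K / ε + 1 with hR
  have hRp : 0 < R := by positivity
  have hRK : K * R < ε / 2 * R ^ 2 := by
    have : ε * R = 2 * K + ε := by rw [hR]; field_simp
    nlinarith
  obtain ⟨z, hz, hzm⟩ := isCompact_Icc.exists_isMinOn (f := fun x => w x - J x)
    (nonempty_Icc.2 (show -R ≤ R by linarith))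
    (hwc.sub (by rw [hJ]; fun_prop)).continuousOn
  have hz0 : w z - J z ≤ w 0 - J 0 := hzm ⟨by linarith, hRp.le⟩
  have hne : |z| ≠ R := fun h => by
    have h1 := (abs_le.1 (hlip z 0)).1
    rw [sub_zero, h] at h1
    have h2 : z ^ 2 = R ^ 2 := by rw [← sq_abs, h]
    simp only [hJ, sub_zero, h2] at hz0
    linarith
  have hz₁ : -R < z := lt_of_le_of_ne hz.1 (by
    rintro rfl; rw [abs_neg, abs_of_pos hRp] at hne; exact hne rfl)
  have hz₂ : z < R := lt_of_le_of_ne hz.2 (by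
    rintro rfl; rw [abs_of_pos hRp] at hne; exact hne rfl)
  have := hw.le_of_isLocalMin (mem_univ z)
    (Eventually.of_forall fun x => hasDerivAt_parabola 0 (-ε) 0 x)
    (hasDerivAt_parabola_slope 0 (-ε) 0 z) (hzm.isLocalMin (Icc_mem_nhds hz₁ hz₂))
  have h2 := hI z (0 + -ε * (z - 0))
  nlinarith [ha1 z]

theorem exists_coerciveAbove {G : ℝ → ℝ → ℝ} {α₀ γ l K : ℝ} (hα₀ : 0 < α₀) (hγ : 2 < γ)
    (hK : 0 < K) (hG : ∀ x p, α₀ * |p| ^ γ - 1 / α₀ ≤ G x p) (hl : 0 ≤ l + 1 / α₀)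
    (hlK : l + 1 / α₀ < α₀ * K ^ γ) :
    ∃ l' c, l < l' ∧ CoerciveAbove G l' K c (1 / α₀) := by
  set σ := α₀ * K ^ γ - (l + 1 / α₀) with hσ
  have hσp : 0 < σ := sub_pos.2 hlK
  -- The slack `σ` is split: a quarter raises the level, half feeds the quadratic growth through
  -- `(|p| / K) ^ 2 ≤ (|p| / K) ^ γ`, and the rest keeps the inequality strict.
  refine ⟨l + σ / 4, σ / 2 / K ^ 2, by linarith, hK, by positivity, fun x p => ?_, fun x p hp => ?_⟩
  · have := hG x p
    have h2 : 0 ≤ α₀ * |p| ^ γ := by positivity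
    linarith
  · have h1 : 1 ≤ |p| / K := (one_le_div hK).2 hp
    have h2 : (|p| / K) ^ (2 : ℕ) ≤ (|p| / K) ^ γ := by
      rw [← Real.rpow_natCast]
      exact Real.rpow_le_rpow_of_exponent_le h1 (by norm_num; exact hγ.le)
    have h3 : 1 ≤ (|p| / K) ^ 2 := one_le_pow₀ h1
    have h4 : α₀ * |p| ^ γ = (l + 1 / α₀ + σ) * (|p| / K) ^ γ := by
      rw [Real.div_rpow (abs_nonneg _) hK.le, hσ]
      field_simp
      ring
    have h5 : σ / 2 / K ^ 2 * p ^ 2 = σ / 2 * (|p| / K) ^ 2 := by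
      rw [div_pow, sq_abs]; ring
    rw [h5]
    have h6 := hG x p
    rw [h4] at h6
    nlinarith [mul_le_mul_of_nonneg_left (h3.trans h2) hl, mul_le_mul_of_nonneg_left h2 hσp.le,
      mul_le_mul_of_nonneg_left h3 hσp.le]

theorem HamiltonianClass.continuous {Ω : Type*} {α₀ α₁ γ : ℝ} {H : ℝ → ℝ → Ω → ℝ}
    (h : HamiltonianClass α₀ α₁ γ H) (hγ : 2 < γ) (ω : Ω) :
    Continuous (Function.uncurry fun x p => H x p ω) := by
  refine continuous_iff_continuousAt.2 fun ⟨x₀, p₀⟩ => ?_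
  have hc : Continuous fun z : ℝ × ℝ => α₁ * (|z.2| ^ γ + 1) * |z.1 - x₀| +
      α₁ * (|z.2| + |p₀| + 1) ^ (γ - 1) * |z.2 - p₀| := by
    have h1 : Continuous fun z : ℝ × ℝ => |z.2| ^ γ :=
      continuous_snd.abs.rpow_const fun _ => Or.inr (by linarith)
    have h2 : Continuous fun z : ℝ × ℝ => (|z.2| + |p₀| + 1) ^ (γ - 1) :=
      Continuous.rpow_const (by fun_prop) fun _ => Or.inr (by linarith)
    fun_prop
  have ht := hc.tendsto (x₀, p₀)
  simp only [sub_self, abs_zero, mul_zero, add_zero] at ht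
  rw [ContinuousAt, tendsto_iff_dist_tendsto_zero]
  refine squeeze_zero (fun _ => dist_nonneg) (fun z => ?_) ht
  rw [Real.dist_eq]
  calc |H z.1 z.2 ω - H x₀ p₀ ω|
      = |(H z.1 z.2 ω - H x₀ z.2 ω) + (H x₀ z.2 ω - H x₀ p₀ ω)| := by congr 1; ring
    _ ≤ |H z.1 z.2 ω - H x₀ z.2 ω| + |H x₀ z.2 ω - H x₀ p₀ ω| := abs_add_le _ _
    _ ≤ _ := add_le_add (h.lipschitz_x _ _ _ _) (h.lipschitz_p _ _ _ _)

theorem lipConst_pos {α₀ α₁ γ κ l : ℝ} (hα₀ : 0 < α₀) (hα₁ : 0 < α₁) (hκ : 0 < κ)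
    (hl : 0 ≤ l + 1 / α₀) (hγ : 2 < γ) :
    0 < lipConst 1 α₀ α₁ γ κ l ∧ l + 1 / α₀ < α₀ * lipConst 1 α₀ α₁ γ κ l ^ γ := by
  have h1 : 0 < (κ * (√(1 + α₁ + |l|) / α₀)) ^ (2 / (γ - 1)) := by positivity
  have hB : (1 + l * α₀) / α₀ ^ 2 = (l + 1 / α₀) / α₀ := by field_simp; ring
  have hB0 : 0 ≤ (1 + l * α₀) / α₀ ^ 2 := by rw [hB]; positivity
  have h2 : 0 ≤ ((1 + l * α₀) / α₀ ^ 2) ^ (1 / γ) := Real.rpow_nonneg hB0 _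
  unfold lipConst
  rw [one_mul]
  refine ⟨by linarith, ?_⟩
  have h3 : (((1 + l * α₀) / α₀ ^ 2) ^ (1 / γ)) ^ γ < ((κ * (√(1 + α₁ + |l|) / α₀)) ^ (2 / (γ - 1)) +
      ((1 + l * α₀) / α₀ ^ 2) ^ (1 / γ)) ^ γ :=
    Real.rpow_lt_rpow h2 (by linarith) (by linarith)
  rw [← Real.rpow_mul hB0, one_div_mul_cancel (by linarith), Real.rpow_one] at h3
  calc l + 1 / α₀ = α₀ * ((1 + l * α₀) / α₀ ^ 2) := by rw [hB]; field_simp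
    _ < _ := by gcongr

theorem SupersolutionOn.le_level_of_growth {a : ℝ → ℝ} {G : ℝ → ℝ → ℝ} {α₀ γ κ l I : ℝ}
    {w : ℝ → ℝ} (ha : DegenerateCoeff κ a) (hα₀ : 0 < α₀) (hγ : 2 < γ)
    (hG : ∀ x p, α₀ * |p| ^ γ - 1 / α₀ ≤ G x p) (hI : ∀ x p, I ≤ G x p)
    (hwc : Continuous w) (hw : SupersolutionOn a G l w univ) : I ≤ l := by
  have hl : 0 ≤ |l| + 1 / α₀ := by positivity
  -- Nonnegativity of `l + 1 / α₀` is not yet known, so the level is raised to `|l|`; any Lipschitz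
  -- constant will do here.
  obtain ⟨hK, hlK⟩ := lipConst_pos (α₁ := 1) hα₀ one_pos ha.kpos hl hγ
  obtain ⟨l', c, hl', hco⟩ := exists_coerciveAbove hα₀ hγ hK hG hl hlK
  exact hw.le_level ha.le_one hI hK
    (hw.lipschitz (hco.mono_level ((le_abs_self l).trans hl'.le)) ha hwc)

end ViscousHJ

theorem theorem3p2 (γ : ℝ) (hγ : 2 < γ) :
    ∃ C : ℝ, 0 < C ∧
      ∀ (α₀ α₁ κ : ℝ), 0 < α₀ → 0 < α₁ → 0 < κ →
      ∀ (Ω : Type*) [MeasurableSpace Ω] (P : Measure Ω) [IsProbabilityMeasure P]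
        (τ : ℝ → Ω → Ω) (a : ℝ → Ω → ℝ) (H : ℝ → ℝ → Ω → ℝ),
        ViscousHJ.IsErgodicFlow P τ →
        ViscousHJ.IsDiffusionCoeff P τ κ a →
        (∀ x y p ω, H (x + y) p ω = H x p (τ y ω)) →
        ViscousHJ.HamiltonianClass α₀ α₁ γ H →
        ∀ ω : Ω,
          (∀ l : ℝ,
            ViscousHJ.criticalValue (fun x => a x ω) (fun x p => H x p ω) ≤ (l : EReal) →
            0 < ViscousHJ.lipConst C α₀ α₁ γ κ l ∧
            ∃ u : ℝ → ℝ,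
              ViscousHJ.IsViscositySolution (fun x => a x ω) (fun x p => H x p ω) l u ∧
              (∀ x y, |u x - u y| ≤ ViscousHJ.lipConst C α₀ α₁ γ κ l * |x - y|) ∧
              ((∀ x, 0 < a x ω) → ContDiff ℝ 2 u)) ∧
          (((⨅ z : ℝ × ℝ, H z.1 z.2 ω : ℝ) : EReal) ≤
            ViscousHJ.criticalValue (fun x => a x ω) (fun x p => H x p ω)) ∧
          -1 / α₀ ≤ ⨅ z : ℝ × ℝ, H z.1 z.2 ω := by
  refine ⟨1, one_pos, fun α₀ α₁ κ hα₀ hα₁ hκ Ω _ P _ τ a H _ ha _ hH ω => ?_⟩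
  have haω : ViscousHJ.DegenerateCoeff κ (fun x => a x ω) :=
    ⟨hκ, fun x => (ha.mem_Icc x ω).1, fun x => (ha.mem_Icc x ω).2, ha.sqrt_lipschitz ω⟩
  have hlow : ∀ x p, α₀ * |p| ^ γ - 1 / α₀ ≤ H x p ω := fun x p => hH.lower x p ω
  have hlow' : ∀ x p, -1 / α₀ ≤ H x p ω := fun x p => by
    have h1 := hlow x p
    have h2 : 0 ≤ α₀ * |p| ^ γ := by positivity
    rw [neg_div]
    linarith
  have hbdd : BddBelow (Set.range fun z : ℝ × ℝ => H z.1 z.2 ω) :=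
    ⟨-1 / α₀, by rintro _ ⟨z, rfl⟩; exact hlow' z.1 z.2⟩
  have hinf : -1 / α₀ ≤ ⨅ z : ℝ × ℝ, H z.1 z.2 ω := le_ciInf fun z => hlow' z.1 z.2
  have hcrit : ((⨅ z : ℝ × ℝ, H z.1 z.2 ω : ℝ) : EReal) ≤
      ViscousHJ.criticalValue (fun x => a x ω) (fun x p => H x p ω) := by
    refine le_sInf ?_
    rintro _ ⟨l, ⟨w, hw⟩, rfl⟩
    obtain ⟨hwc, hw⟩ := ViscousHJ.isViscositySupersolution_iff.1 hw
    exact EReal.coe_le_coe_iff.2 (hw.le_level_of_growth haω hα₀ hγ hlow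
      (fun x p => ciInf_le hbdd (x, p)) hwc)
  refine ⟨fun l hl => ?_, hcrit, hinf⟩
  have hl0 : 0 ≤ l + 1 / α₀ := by
    have := hinf.trans (EReal.coe_le_coe_iff.1 (hcrit.trans hl))
    rw [neg_div] at this
    linarith
  obtain ⟨hK, hlK⟩ := ViscousHJ.lipConst_pos hα₀ hα₁ hκ hl0 hγ
  obtain ⟨l', c, hl', hco⟩ := ViscousHJ.exists_coerciveAbove hα₀ hγ hK hlow hl0 hlK
  have hHc := hH.continuous hγ ω
  -- The infimum defining the critical value need not be known to be attained: levels below `l + δ`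
  -- suffice, and compactness reaches `l`.
  obtain ⟨w, hwc, hw⟩ := ViscousHJ.exists_supersolution_of_forall_lt hl' hco haω hHc fun δ hδ => by
    have hlt : ViscousHJ.criticalValue (fun x => a x ω) (fun x p => H x p ω) < (l + δ : ℝ) :=
      hl.trans_lt (EReal.coe_lt_coe_iff.2 (by linarith))
    obtain ⟨_, ⟨l₁, ⟨w, hw⟩, rfl⟩, hlt⟩ := sInf_lt_iff.1 hlt
    obtain ⟨hwc, hw⟩ := ViscousHJ.isViscositySupersolution_iff.1 hw
    exact ⟨w, hwc, hw.mono_level (EReal.coe_lt_coe_iff.1 hlt).le⟩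
  obtain ⟨u, hlip, hsup, hsub⟩ :=
    ViscousHJ.exists_solution (hco.mono_level hl'.le) haω hHc hw hwc
  have huc := ViscousHJ.continuous_of_abs_sub_le hK.le hlip
  exact ⟨hK, u, ⟨ViscousHJ.isViscositySubsolution_iff.2 ⟨huc, hsub⟩,
    ViscousHJ.isViscositySupersolution_iff.2 ⟨huc, hsup⟩⟩, hlip, fun hpos =>
    ViscousHJ.contDiff_two_of_solution haω.continuous hpos hHc hlip huc hsup hsub⟩
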